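/- All Hilbert spaces are complex. For an ordinal $n$, an $n$-isometry on a Hilbert space is a family $(V_k)_{0\le k<n}$ of commuting isometric operators on that space. A reducing subspace of a family of commuting isometries is a closed subspace $\mathfrak M$ such that $\mathfrak M$ and $\mathfrak M^\perp$ are invariant for every operator of the family. For a subset $J$ of the index set, the family is $J$-pure if the only reducing subspace to which every operator with index in $J$ restricts as a unitary operator is $\{0\}$. It is completely nonunitary if it is $J$-pure with $J$ the whole index set. Let $\mathbb V=(V_k)_{0\le k<n}$ be an $n$-isometry on $\mathfrak H$ and let $A$ be a contraction ($\|A\|\le 1$) on $\mathfrak H$ commuting with every $V_k$. Let $\widetilde{\mathbb V}=(\widetilde V_k)_{0\le k<n}$ on $\widetilde{\mathfrak H}\supset\mathfrak H$ be the minimal unitary extension of $\mathbb V$, that is, the (essentially unique) family of commuting unitary operators extending $\mathbb V$ such that the vectors $\widetilde V_{k_1}^*\cdots\widetilde V_{k_N}^*h$ ($N\ge 0$, $0\le k_i<n$, $h\in\mathfrak H$) span a dense subspace of $\widetilde{\mathfrak H}$. Let $\widetilde A$ be the unique bounded operator on $\widetilde{\mathfrak H}$ that extends $A$ and commutes with every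 $\widetilde V_k$; it is a contraction. Put $D_{\widetilde A}=(I-\widetilde A^*\widetilde A)^{1/2}$ and $\mathfrak D=\overline{D_{\widetilde A}\widetilde{\mathfrak H}}$, which reduces $\widetilde{\mathbb V}$. The model $\mathbb W_A=(W_k)_{0\le k\le n}$ is the $(n+1)$-isometry on $\mathfrak H\oplus\mathfrak D\oplus\mathfrak D\oplus\cdots$ given by $$W_k(h\oplus d_0\oplus d_1\oplus\cdots)=V_kh\oplus\widetilde V_kd_0\oplus\widetilde V_kd_1\oplus\cdots\quad(0\le k<n),$$ $$W_n(h\oplus d_0\oplus d_1\oplus\cdots)=Ah\oplus D_{\widetilde A}h\oplus d_0\oplus d_1\oplus\cdots.$$ **Theorem.** Let $n\ge 1$ be an ordinal and let $\mathbb W=(W_k)_{0\le k\le n}$ be an $(n+1)$-isometry on a Hilbert space $\mathfrak K$. The following conditions are equivalent. 1. $\mathbb W$ is $\{0\le k<n\}$-pure. 2. There exist a completely nonunitary $n$-isometry $\mathbb V$ on a Hilbert space $\mathfrak H$ and a contraction $A$ on $\mathfrak H$ commuting with every operator of $\mathbb V$ such that $\mathbb W$ is unitarily equivalent to $\mathbb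 W_A$. -/

import Mathlib

universe u v w

noncomputable section

open scoped InnerProductSpace ENNReal

/-! ### Commuting isometries, reducing subspaces, pureness -/

/-- A bounded operator on a Hilbert space is unitary if it is isometric and onto. -/
def IsUnitaryOp {H : Type v} [NormedAddCommGroup H] [InnerProductSpace ℂ H]
    (T : H →L[ℂ] H) : Prop :=
  (∀ x, ‖T x‖ = ‖x‖) ∧ Function.Surjective T

/-- A family, indexed by `ι`, of commuting isometric operators on the space `H`. -/
structure CommutingIsometries (ι : Type u) (H : Type v) [NormedAddCommGroup H]
    [InnerProductSpace ℂ H] where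
  /-- the operators of the family -/
  op : ι → H →L[ℂ] H
  norm_op : ∀ i x, ‖op i x‖ = ‖x‖
  comm : ∀ i j, op i ∘L op j = op j ∘L op i

/-- For an ordinal `n`, an `n`-isometry is a family `(V_k)_{0 ≤ k < n}` of commuting isometries. -/
abbrev NIsometry (n : Ordinal.{u}) (H : Type v) [NormedAddCommGroup H]
    [InnerProductSpace ℂ H] : Type _ :=
  CommutingIsometries (Set.Iio n) H

namespace CommutingIsometries

section Basic

variable {ι : Type u} {H : Type v} [NormedAddCommGroup H] [InnerProductSpace ℂ H]

/-- The subspace `M` is invariant for the family `V`. -/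
def IsInvariant (V : CommutingIsometries ι H) (M : Submodule ℂ H) : Prop :=
  ∀ i, Set.MapsTo (V.op i) M M

/-- The closed subspace `M` is reducing for `V`: both `M` and its orthogonal complement are
invariant for `V`. -/
structure IsReducing (V : CommutingIsometries ι H) (M : Submodule ℂ H) : Prop where
  isClosed : IsClosed (M : Set H)
  invariant : V.IsInvariant M
  invariant_orthogonal : V.IsInvariant Mᗮ

/-- The restriction `V | M` of the family `V` to an invariant subspace `M`. -/
def restrict (V : CommutingIsometries ι H) (M : Submodule ℂ H) (hM : V.IsInvariant M) :
    CommutingIsometries ι M where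
  op i := (V.op i).restrict (hM i)
  norm_op i x := V.norm_op i x
  comm i j := by
    ext x
    exact DFunLike.congr_fun (V.comm i j) (x : H)

/-- The family `V` is `J`-unitary if `V_j` is unitary for every `j ∈ J`. -/
def IsUnitaryOn (V : CommutingIsometries ι H) (J : Set ι) : Prop :=
  ∀ j ∈ J, IsUnitaryOp (V.op j)

/-- The family `V` is `J`-pure if it has no `J`-unitary direct summand acting on a nonzero
space. -/
def IsPure (V : CommutingIsometries ι H) (J : Set ι) : Prop :=
  ∀ (M : Submodule ℂ H) (hM : V.IsReducing M),
    (V.restrict M hM.invariant).IsUnitaryOn J → M = ⊥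

/-- The family `V` is completely nonunitary if it has no unitary direct summand acting on a
nonzero space. -/
def IsCompletelyNonunitary (V : CommutingIsometries ι H) : Prop :=
  V.IsPure Set.univ

/-- The operator `A` belongs to the commutant of the family `V`. -/
def InCommutant (V : CommutingIsometries ι H) (A : H →L[ℂ] H) : Prop :=
  ∀ i, A ∘L V.op i = V.op i ∘L A

/-- Unitary equivalence of two families with the same index set. -/
def UnitarilyEquivalent {K : Type w} [NormedAddCommGroup K] [InnerProductSpace ℂ K]
    (V : CommutingIsometries ι H) (W : CommutingIsometries ι K) : Prop :=
  ∃ Φ : H ≃ₗᵢ[ℂ] K, ∀ i x, Φ (V.op i x) = W.op i (Φ x)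

end Basic

section Extension

variable {ι : Type u} {H : Type v} [NormedAddCommGroup H] [InnerProductSpace ℂ H]

/-- A minimal unitary extension of the family `V` on `H`: a family `U` of commuting unitary
operators on a Hilbert space containing `H` (through the isometric embedding `emb`), which extends
`V`, and such that the vectors `U_{k_1}^* ⋯ U_{k_N}^* h`, with `N ≥ 0` and `h ∈ H`, span a dense
subspace. -/
structure MinimalUnitaryExtension (V : CommutingIsometries ι H) where
  /-- the larger Hilbert space -/
  space : Type v
  [normedAddCommGroup : NormedAddCommGroup space]
  [innerProductSpace : InnerProductSpace ℂ space]
  [completeSpace : CompleteSpace space]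
  /-- the commuting unitary operators -/
  family : CommutingIsometries ι space
  unitary : ∀ i, IsUnitaryOp (family.op i)
  /-- the inclusion of the original space -/
  emb : H →ₗᵢ[ℂ] space
  extends_op : ∀ i h, family.op i (emb h) = emb (V.op i h)
  minimal : (Submodule.span ℂ {x : space | ∃ (l : List ι) (h : H),
    x = (l.map fun k => ContinuousLinearMap.adjoint (family.op k)).prod (emb h)}).topologicalClosure
      = ⊤

attribute [instance] MinimalUnitaryExtension.normedAddCommGroup
  MinimalUnitaryExtension.innerProductSpace MinimalUnitaryExtension.completeSpace

end Extension

section Existence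

variable {ι : Type u}

theorem adjoint_apply_self_of_norm {E : Type w} [NormedAddCommGroup E] [InnerProductSpace ℂ E]
    [CompleteSpace E] {s : E →L[ℂ] E} (hs : ∀ x, ‖s x‖ = ‖x‖) (x : E) :
    ContinuousLinearMap.adjoint s (s x) = x :=
  DFunLike.congr_fun ((ContinuousLinearMap.norm_map_iff_adjoint_comp_self s).1 hs) x

theorem norm_adjoint_apply_le {E : Type w} [NormedAddCommGroup E] [InnerProductSpace ℂ E]
    [CompleteSpace E] {s : E →L[ℂ] E} (hs : ∀ x, ‖s x‖ = ‖x‖) (x : E) :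
    ‖ContinuousLinearMap.adjoint s x‖ ≤ ‖x‖ := by
  have h1 : ‖ContinuousLinearMap.adjoint s‖ ≤ 1 := by
    rw [LinearIsometryEquiv.norm_map]
    exact s.opNorm_le_bound zero_le_one fun x => by rw [hs, one_mul]
  exact (ContinuousLinearMap.le_of_opNorm_le _ h1 x).trans (one_mul _).le

theorem adjoint_prod_foldr {E : Type w} [NormedAddCommGroup E] [InnerProductSpace ℂ E]
    [CompleteSpace E] (U : CommutingIsometries ι E) (l : List ι) (x : E) :
    ((l.reverse.map fun k => ContinuousLinearMap.adjoint (U.op k)).prod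
      (l.foldr (fun k y => U.op k y) x)) = x := by
  induction l with
  | nil => rfl
  | cons k l ih =>
    rw [List.reverse_cons, List.map_append, List.prod_append, List.map_cons, List.prod_cons,
      mul_apply_eq_comp, mul_apply_eq_comp, List.map_nil, List.prod_nil, one_apply_eq_self,
      List.foldr_cons, adjoint_apply_self_of_norm (U.norm_op k), ih]

theorem norm_prod_adjoint_le {E : Type w} [NormedAddCommGroup E] [InnerProductSpace ℂ E]
    [CompleteSpace E] (U : CommutingIsometries ι E) (l : List ι) (x : E) :
    ‖(l.map fun k => ContinuousLinearMap.adjoint (U.op k)).prod x‖ ≤ ‖x‖ := by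
  induction l with
  | nil => rfl
  | cons k l ih =>
    rw [List.map_cons, List.prod_cons, mul_apply_eq_comp]
    exact (norm_adjoint_apply_le (U.norm_op k) _).trans ih

/-- A criterion for the minimality of a unitary extension. -/
theorem minimal_of_forall {A : Type v} {E : Type w} [NormedAddCommGroup E] [InnerProductSpace ℂ E]
    [CompleteSpace E] (U : CommutingIsometries ι E) (emb : A → E)
    (hU : ∀ (x : E) (ε : ℝ), 0 < ε → ∃ (l : List ι) (h : A),
      ‖l.foldr (fun k y => U.op k y) x - emb h‖ < ε) :
    (Submodule.span ℂ {x : E | ∃ (l : List ι) (h : A),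
      x = (l.map fun k => ContinuousLinearMap.adjoint (U.op k)).prod (emb h)}).topologicalClosure
        = ⊤ := by
  rw [← Submodule.dense_iff_topologicalClosure_eq_top]
  intro x
  rw [Metric.mem_closure_iff]
  intro ε hε
  obtain ⟨l, h, hlt⟩ := hU x ε hε
  refine ⟨_, Submodule.subset_span ⟨l.reverse, h, rfl⟩, ?_⟩
  rw [dist_eq_norm]
  refine lt_of_le_of_lt ?_ hlt
  conv_lhs => enter [1, 1]; rw [← adjoint_prod_foldr U l x]
  rw [← map_sub]
  exact norm_prod_adjoint_le _ _ _

theorem parallelogram_of_le {E : Type w} [NormedAddCommGroup E] [NormedSpace ℂ E]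
    (h : ∀ f g : E, ‖f + g‖ * ‖f + g‖ + ‖f - g‖ * ‖f - g‖ ≤ 2 * (‖f‖ * ‖f‖ + ‖g‖ * ‖g‖))
    (f g : E) : ‖f + g‖ * ‖f + g‖ + ‖f - g‖ * ‖f - g‖ = 2 * (‖f‖ * ‖f‖ + ‖g‖ * ‖g‖) := by
  refine le_antisymm (h f g) ?_
  have h := h (f + g) (f - g)
  have e1 : f + g + (f - g) = (2 : ℂ) • f := by module
  have e2 : f + g - (f - g) = (2 : ℂ) • g := by module
  have e3 : ‖(2 : ℂ)‖ = 2 := by simp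
  rw [e1, e2, norm_smul, norm_smul, e3] at h
  linarith


variable {H : Type v} [NormedAddCommGroup H] [InnerProductSpace ℂ H]

/-- The monoid of operators generated by the family. -/
def monoid (V : CommutingIsometries ι H) : Submonoid (H →L[ℂ] H) :=
  Submonoid.closure (Set.range V.op)

theorem op_mem_monoid (V : CommutingIsometries ι H) (i : ι) : V.op i ∈ V.monoid :=
  Submonoid.subset_closure ⟨i, rfl⟩

theorem monoid_comm (V : CommutingIsometries ι H) {s t : H →L[ℂ] H} (hs : s ∈ V.monoid)
    (ht : t ∈ V.monoid) : s * t = t * s := by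
  have h1 : V.monoid ≤ Submonoid.centralizer (Set.range V.op) := by
    refine Submonoid.closure_le.2 ?_
    rintro _ ⟨i, rfl⟩
    rw [SetLike.mem_coe, Submonoid.mem_centralizer_iff]
    rintro _ ⟨j, rfl⟩
    exact V.comm j i
  have h2 : V.monoid ≤ Submonoid.centralizer (V.monoid : Set (H →L[ℂ] H)) := by
    refine Submonoid.closure_le.2 ?_
    rintro _ ⟨i, rfl⟩
    rw [SetLike.mem_coe, Submonoid.mem_centralizer_iff]
    intro g hg
    exact ((Submonoid.mem_centralizer_iff.1 (h1 hg)) _ ⟨i, rfl⟩).symm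
  exact (Submonoid.mem_centralizer_iff.1 (h2 ht)) _ hs

theorem monoid_norm (V : CommutingIsometries ι H) {s : H →L[ℂ] H} (hs : s ∈ V.monoid) :
    ∀ x, ‖s x‖ = ‖x‖ := by
  induction hs using Submonoid.closure_induction with
  | mem s hs => obtain ⟨i, rfl⟩ := hs; exact V.norm_op i
  | one => intro x; rfl
  | mul s t _ _ h1 h2 => intro x; rw [mul_apply_eq_comp, h1, h2]

theorem exists_list_of_mem_monoid (V : CommutingIsometries ι H) {s : H →L[ℂ] H}
    (hs : s ∈ V.monoid) : ∃ l : List ι, s = (l.map V.op).prod := by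
  induction hs using Submonoid.closure_induction with
  | mem s hs => obtain ⟨i, rfl⟩ := hs; exact ⟨[i], by simp⟩
  | one => exact ⟨[], rfl⟩
  | mul s t _ _ h1 h2 =>
    obtain ⟨l, rfl⟩ := h1
    obtain ⟨m, rfl⟩ := h2
    exact ⟨l ++ m, by simp⟩


variable [CompleteSpace H]

/-- Bounded families `(f s)`, indexed by the monoid `S` generated by the `V_k`, with
`t^* f (s t) = f s`. This is a concrete model of the space of the minimal unitary extension. -/
def coherent (V : CommutingIsometries ι H) : Submodule ℂ (lp (fun _ : V.monoid => H) ∞) where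
  carrier := {f | ∀ s t : V.monoid, ContinuousLinearMap.adjoint t.1 (f (s * t)) = f s}
  add_mem' {f g} hf hg s t := by
    simp only [lp.coeFn_add, Pi.add_apply, map_add, hf s t, hg s t]
  zero_mem' s t := by simp
  smul_mem' c f hf s t := by
    have h := hf s t
    simp only [lp.coeFn_smul, Pi.smul_apply, map_smul, h]

theorem coherent_isClosed (V : CommutingIsometries ι H) :
    IsClosed (V.coherent : Set (lp (fun _ : V.monoid => H) ∞)) := by
  have he : ∀ s : V.monoid, Continuous fun f : lp (fun _ : V.monoid => H) ∞ => f s := fun s =>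
    (lp.lipschitzWith_one_eval (E := fun _ : V.monoid => H) ∞ s).continuous
  have : (V.coherent : Set (lp (fun _ : V.monoid => H) ∞)) =
      ⋂ s : V.monoid, ⋂ t : V.monoid,
        {f | ContinuousLinearMap.adjoint t.1 (f (s * t)) = f s} := by
    ext f; simp [coherent]
  rw [this]
  exact isClosed_iInter fun s => isClosed_iInter fun t =>
    isClosed_eq ((ContinuousLinearMap.adjoint t.1).continuous.comp (he _)) (he _)

theorem coherent_norm_mono (V : CommutingIsometries ι H) (f : V.coherent) (s t : V.monoid) :
    ‖f.1 s‖ ≤ ‖f.1 (s * t)‖ := by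
  rw [← f.2 s t]
  exact norm_adjoint_apply_le (V.monoid_norm t.2) _

theorem coherent_norm_mono' (V : CommutingIsometries ι H) (f : V.coherent) (s t : V.monoid) :
    ‖f.1 s‖ ≤ ‖f.1 (t * s)‖ := by
  have : t * s = s * t := Subtype.ext (V.monoid_comm t.2 s.2)
  rw [this]
  exact V.coherent_norm_mono f s t

theorem coherent_apply_le (V : CommutingIsometries ι H) (f : V.coherent) (s : V.monoid) :
    ‖f.1 s‖ ≤ ‖f‖ :=
  lp.norm_apply_le_norm ENNReal.top_ne_zero f.1 s

theorem coherent_sq_le (V : CommutingIsometries ι H) (f : V.coherent) {C : ℝ}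
    (h : ∀ s, ‖f.1 s‖ * ‖f.1 s‖ ≤ C) : ‖f‖ * ‖f‖ ≤ C := by
  have hC : 0 ≤ C := (mul_self_nonneg _).trans (h 1)
  have : ‖f.1‖ ≤ √C := lp.norm_le_of_forall_le (Real.sqrt_nonneg _) fun s =>
    Real.le_sqrt_of_sq_le (by rw [sq]; exact h s)
  calc ‖f‖ * ‖f‖ ≤ √C * √C := mul_self_le_mul_self (norm_nonneg _) this
    _ = C := Real.mul_self_sqrt hC

theorem coherent_parallelogram_le (V : CommutingIsometries ι H) (f g : V.coherent) :
    ‖f + g‖ * ‖f + g‖ + ‖f - g‖ * ‖f - g‖ ≤ 2 * (‖f‖ * ‖f‖ + ‖g‖ * ‖g‖) := by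
  rw [← le_sub_iff_add_le]
  refine V.coherent_sq_le _ fun s => ?_
  rw [le_sub_comm]
  refine V.coherent_sq_le _ fun t => ?_
  rw [le_sub_iff_add_le, add_comm]
  have h1 := mul_self_le_mul_self (norm_nonneg _) (V.coherent_norm_mono (f + g) s t)
  have h2 := mul_self_le_mul_self (norm_nonneg _) (V.coherent_norm_mono' (f - g) t s)
  have h3 := parallelogram_law_with_norm ℂ (f.1 (s * t)) (g.1 (s * t))
  have h4 := mul_self_le_mul_self (norm_nonneg _) (V.coherent_apply_le f (s * t))
  have h5 := mul_self_le_mul_self (norm_nonneg _) (V.coherent_apply_le g (s * t))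
  have e1 : (f + g).1 (s * t) = f.1 (s * t) + g.1 (s * t) := rfl
  have e2 : (f - g).1 (s * t) = f.1 (s * t) - g.1 (s * t) := rfl
  rw [e1] at h1
  rw [e2] at h2
  linarith

instance coherentInnerProductSpace (V : CommutingIsometries ι H) :
    InnerProductSpace ℂ V.coherent :=
  InnerProductSpace.ofNorm ℂ (parallelogram_of_le V.coherent_parallelogram_le)

instance coherentCompleteSpace (V : CommutingIsometries ι H) : CompleteSpace V.coherent :=
  V.coherent_isClosed.completeSpace_coe

/-- A bounded family, as a coherent family. -/
def coherentMk (V : CommutingIsometries ι H) (f : V.monoid → H) (C : ℝ) (hC : ∀ s, ‖f s‖ ≤ C)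
    (hf : ∀ s t : V.monoid, ContinuousLinearMap.adjoint t.1 (f (s * t)) = f s) : V.coherent :=
  ⟨⟨f, memℓp_infty ⟨C, by rintro _ ⟨s, rfl⟩; exact hC s⟩⟩, hf⟩

theorem coherentMk_le (V : CommutingIsometries ι H) (f : V.monoid → H) (C : ℝ)
    (hC : ∀ s, ‖f s‖ ≤ C)
    (hf : ∀ s t : V.monoid, ContinuousLinearMap.adjoint t.1 (f (s * t)) = f s) (s : V.monoid) :
    ‖f s‖ ≤ ‖V.coherentMk f C hC hf‖ :=
  V.coherent_apply_le (V.coherentMk f C hC hf) s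

/-- The translation `(U_i f) s = f (V_i s)` on coherent families. -/
def coherentShift (V : CommutingIsometries ι H) (i : ι) (f : V.coherent) : V.coherent :=
  V.coherentMk (fun s => f.1 (⟨V.op i, V.op_mem_monoid i⟩ * s)) ‖f‖
    (fun _ => V.coherent_apply_le f _) (fun s t => by rw [← mul_assoc]; exact f.2 _ t)

theorem norm_coherentShift (V : CommutingIsometries ι H) (i : ι) (f : V.coherent) :
    ‖V.coherentShift i f‖ = ‖f‖ := by
  refine le_antisymm ?_ ?_
  · exact lp.norm_le_of_forall_le (norm_nonneg _) fun s => V.coherent_apply_le f _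
  · refine lp.norm_le_of_forall_le (norm_nonneg _) fun s => ?_
    exact (V.coherent_norm_mono' f s ⟨V.op i, V.op_mem_monoid i⟩).trans
      (V.coherent_apply_le (V.coherentShift i f) s)

/-- The translation, as a linear isometry. -/
def coherentOp (V : CommutingIsometries ι H) (i : ι) : V.coherent →ₗᵢ[ℂ] V.coherent where
  toFun f := V.coherentShift i f
  map_add' _ _ := rfl
  map_smul' _ _ := rfl
  norm_map' f := V.norm_coherentShift i f

theorem coherentOp_apply (V : CommutingIsometries ι H) (i : ι) (f : V.coherent) (s : V.monoid) :
    (V.coherentOp i f).1 s = f.1 (⟨V.op i, V.op_mem_monoid i⟩ * s) := rfl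

/-- The coherent family `(s h)_s`. -/
def coherentIncl (V : CommutingIsometries ι H) (h : H) : V.coherent :=
  V.coherentMk (fun s => s.1 h) ‖h‖ (fun s => (V.monoid_norm s.2 h).le) (fun s t => by
    have : (s * t).1 h = t.1 (s.1 h) := by
      rw [Submonoid.coe_mul, V.monoid_comm s.2 t.2]; rfl
    rw [this, adjoint_apply_self_of_norm (V.monoid_norm t.2)])

/-- The inclusion of `H` in the space of coherent families, `h ↦ (s h)_s`. -/
def coherentEmb (V : CommutingIsometries ι H) : H →ₗᵢ[ℂ] V.coherent where
  toFun h := V.coherentIncl h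
  map_add' f g := by
    apply Subtype.ext; apply lp.ext; funext s; exact map_add s.1 f g
  map_smul' c f := by
    apply Subtype.ext; apply lp.ext; funext s; exact map_smul s.1 c f
  norm_map' h := by
    refine le_antisymm ?_ ?_
    · exact lp.norm_le_of_forall_le (norm_nonneg _) fun s => (V.monoid_norm s.2 h).le
    · exact V.coherent_apply_le (V.coherentIncl h) 1

/-- The translations, as a family of commuting isometries. -/
def coherentFamily (V : CommutingIsometries ι H) : CommutingIsometries ι V.coherent where
  op i := (V.coherentOp i).toContinuousLinearMap
  norm_op i f := (V.coherentOp i).norm_map f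
  comm i j := by
    refine ContinuousLinearMap.ext fun f => ?_
    apply Subtype.ext; apply lp.ext; funext s
    change f.1 (_ * (_ * s)) = f.1 (_ * (_ * s))
    have e : (⟨V.op j, V.op_mem_monoid j⟩ * ⟨V.op i, V.op_mem_monoid i⟩ : V.monoid) =
        ⟨V.op i, V.op_mem_monoid i⟩ * ⟨V.op j, V.op_mem_monoid j⟩ := Subtype.ext (V.comm j i)
    rw [← mul_assoc, ← mul_assoc, e]

theorem coherentFamily_apply (V : CommutingIsometries ι H) (i : ι) (f : V.coherent)
    (s : V.monoid) :
    (V.coherentFamily.op i f).1 s = f.1 (⟨V.op i, V.op_mem_monoid i⟩ * s) := rfl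

theorem coherentFamily_unitary (V : CommutingIsometries ι H) (i : ι) :
    IsUnitaryOp (V.coherentFamily.op i) := by
  refine ⟨V.coherentFamily.norm_op i, fun f => ?_⟩
  refine ⟨V.coherentMk (fun s => ContinuousLinearMap.adjoint (V.op i) (f.1 s)) ‖f‖
    (fun s => (norm_adjoint_apply_le (V.norm_op i) _).trans (V.coherent_apply_le f s))
    (fun s t => ?_), ?_⟩
  · rw [← f.2 s t, ← ContinuousLinearMap.comp_apply, ← ContinuousLinearMap.comp_apply,
      ← ContinuousLinearMap.adjoint_comp, ← ContinuousLinearMap.adjoint_comp]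
    congr 2
    exact V.monoid_comm (V.op_mem_monoid i) t.2
  · apply Subtype.ext; apply lp.ext; funext s
    change ContinuousLinearMap.adjoint (V.op i) (f.1 (_ * s)) = f.1 s
    have e : (⟨V.op i, V.op_mem_monoid i⟩ : V.monoid) * s = s * ⟨V.op i, V.op_mem_monoid i⟩ :=
      Subtype.ext (V.monoid_comm (V.op_mem_monoid i) s.2)
    rw [← f.2 s ⟨V.op i, V.op_mem_monoid i⟩, e]

theorem coherentFamily_foldr_apply (V : CommutingIsometries ι H) (l : List ι) :
    ∀ (f : V.coherent) (s t : V.monoid), t.1 = (l.map V.op).prod →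
      (l.foldr (fun k g => V.coherentFamily.op k g) f).1 s = f.1 (s * t) := by
  induction l with
  | nil =>
    intro f s t ht
    have e : t = 1 := Subtype.ext ht
    rw [e, mul_one s]; rfl
  | cons k l ih =>
    intro f s t ht
    have hl : (l.map V.op).prod ∈ V.monoid :=
      Submonoid.list_prod_mem _ fun x hx => by
        obtain ⟨i, -, rfl⟩ := List.mem_map.1 hx
        exact V.op_mem_monoid i
    have h := ih f (⟨V.op k, V.op_mem_monoid k⟩ * s) ⟨_, hl⟩ rfl
    rw [List.foldr_cons, coherentFamily_apply, h]
    suffices e : ⟨V.op k, V.op_mem_monoid k⟩ * s * ⟨(l.map V.op).prod, hl⟩ = s * t by rw [e]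
    apply Subtype.ext
    have e1 : t.1 = V.op k * (l.map V.op).prod := by
      rw [ht, List.map_cons, List.prod_cons]
    change V.op k * s.1 * _ = s.1 * t.1
    rw [e1, V.monoid_comm (V.op_mem_monoid k) s.2, mul_assoc]

/-- `‖g - g 1‖² ≤ ‖g‖² - ‖g 1‖²` for a coherent family `g`. -/
theorem coherent_sub_emb (V : CommutingIsometries ι H) (g : V.coherent) :
    ‖g - V.coherentEmb (g.1 1)‖ * ‖g - V.coherentEmb (g.1 1)‖ ≤
      ‖g‖ * ‖g‖ - ‖g.1 1‖ * ‖g.1 1‖ := by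
  refine V.coherent_sq_le _ fun t => ?_
  have e : (g - V.coherentEmb (g.1 1)).1 t = g.1 t - t.1 (g.1 1) := rfl
  have h1 : ⟪g.1 t, t.1 (g.1 1)⟫_ℂ = ⟪g.1 1, g.1 1⟫_ℂ := by
    rw [← ContinuousLinearMap.adjoint_inner_left]
    have := g.2 1 t
    rw [one_mul] at this
    rw [this]
  have h2 := norm_sub_mul_self (𝕜 := ℂ) (g.1 t) (t.1 (g.1 1))
  rw [h1, inner_self_eq_norm_mul_norm, V.monoid_norm t.2] at h2
  have h3 := mul_self_le_mul_self (norm_nonneg _) (V.coherent_apply_le g t)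
  rw [e, h2]
  linarith

theorem coherentFamily_emb (V : CommutingIsometries ι H) (i : ι) (h : H) :
    V.coherentFamily.op i (V.coherentEmb h) = V.coherentEmb (V.op i h) := by
  apply Subtype.ext; apply lp.ext; funext s
  change (V.op i * s.1) h = s.1 (V.op i h)
  rw [V.monoid_comm (V.op_mem_monoid i) s.2]; rfl

theorem coherent_exists_lt (V : CommutingIsometries ι H) (f : V.coherent) (ε : ℝ)
    (hε : 0 < ε) : ∃ s, ‖f‖ * ‖f‖ - ε * ε < ‖f.1 s‖ * ‖f.1 s‖ := by
  by_contra hcon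
  have h1 := V.coherent_sq_le f fun s => not_lt.1 fun hs => hcon ⟨s, hs⟩
  have h2 := mul_pos hε hε
  linarith

theorem coherent_approx_aux (V : CommutingIsometries ι H) (f g : V.coherent) (ε : ℝ)
    (hε : 0 < ε) (s : V.monoid) (hs : ‖f‖ * ‖f‖ - ε * ε < ‖f.1 s‖ * ‖f.1 s‖)
    (hg : ∀ t, g.1 t = f.1 (t * s)) : ‖g - V.coherentEmb (f.1 s)‖ < ε := by
  have hg1 : g.1 1 = f.1 s := by rw [hg 1, one_mul]
  have hgn : ‖g‖ ≤ ‖f‖ := by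
    refine lp.norm_le_of_forall_le (norm_nonneg _) fun t => ?_
    change ‖g.1 t‖ ≤ ‖f‖
    rw [hg t]
    exact V.coherent_apply_le f _
  have hsub := V.coherent_sub_emb g
  rw [hg1] at hsub
  have := mul_self_le_mul_self (norm_nonneg _) hgn
  exact lt_of_mul_self_lt_mul_self₀ hε.le (lt_of_le_of_lt hsub (by linarith))

theorem coherent_approx_aux' (V : CommutingIsometries ι H) (f : V.coherent) (ε : ℝ)
    (hε : 0 < ε) (s : V.monoid) (hs : ‖f‖ * ‖f‖ - ε * ε < ‖f.1 s‖ * ‖f.1 s‖)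
    (l : List ι) (hl : s.1 = (l.map V.op).prod) :
    ‖l.foldr (fun k y => V.coherentFamily.op k y) f - V.coherentEmb (f.1 s)‖ < ε := by
  have h := fun t => V.coherentFamily_foldr_apply l f t s hl
  exact V.coherent_approx_aux f _ ε hε s hs h

theorem coherentFamily_approx (V : CommutingIsometries ι H) (f : V.coherent) (ε : ℝ)
    (hε : 0 < ε) : ∃ (l : List ι) (h : H),
      ‖l.foldr (fun k y => V.coherentFamily.op k y) f - V.coherentEmb h‖ < ε := by
  have h1 := V.coherent_exists_lt f ε hε
  have h2 := fun s : V.monoid => V.exists_list_of_mem_monoid s.2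
  exact h1.elim fun s hs => (h2 s).elim fun l hl =>
    ⟨l, f.1 s, V.coherent_approx_aux' f ε hε s hs l hl⟩

/-- The space of coherent families, as a minimal unitary extension. -/
def coherentExtension (V : CommutingIsometries ι H) : V.MinimalUnitaryExtension where
  space := V.coherent
  family := V.coherentFamily
  unitary := V.coherentFamily_unitary
  emb := V.coherentEmb
  extends_op := V.coherentFamily_emb
  minimal := minimal_of_forall _ _ V.coherentFamily_approx

/-- The minimal unitary extension of the family `V` (it is unique up to unitary equivalence). -/
def minimalUnitaryExtension (V : CommutingIsometries ι H) : V.MinimalUnitaryExtension :=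
  V.coherentExtension

end Existence

section CommutantExtension

variable {ι : Type u} {H : Type v} [NormedAddCommGroup H] [InnerProductSpace ℂ H]

/-- The product of the operators of the family along a finite list of indices. -/
def word (V : CommutingIsometries ι H) (l : List ι) : H →L[ℂ] H := (l.map V.op).prod

theorem word_mem (V : CommutingIsometries ι H) (l : List ι) : V.word l ∈ V.monoid :=
  Submonoid.list_prod_mem _ fun x hx => by
    obtain ⟨i, -, rfl⟩ := List.mem_map.1 hx
    exact V.op_mem_monoid i

theorem word_nil (V : CommutingIsometries ι H) (x : H) : V.word [] x = x := rfl

theorem word_cons (V : CommutingIsometries ι H) (k : ι) (l : List ι) (x : H) :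
    V.word (k :: l) x = V.op k (V.word l x) := by
  rw [word, List.map_cons, List.prod_cons]; rfl

theorem word_append (V : CommutingIsometries ι H) (l m : List ι) (x : H) :
    V.word (l ++ m) x = V.word l (V.word m x) := by
  rw [word, List.map_append, List.prod_append]; rfl

theorem word_comm (V : CommutingIsometries ι H) (l m : List ι) (x : H) :
    V.word l (V.word m x) = V.word m (V.word l x) :=
  DFunLike.congr_fun (V.monoid_comm (V.word_mem l) (V.word_mem m)) x

theorem word_op_comm (V : CommutingIsometries ι H) (l : List ι) (i : ι) (x : H) :
    V.word l (V.op i x) = V.op i (V.word l x) :=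
  DFunLike.congr_fun (V.monoid_comm (V.word_mem l) (V.op_mem_monoid i)) x

theorem InCommutant.apply {V : CommutingIsometries ι H} {A : H →L[ℂ] H} (hA : V.InCommutant A)
    (i : ι) (x : H) : A (V.op i x) = V.op i (A x) :=
  DFunLike.congr_fun (hA i) x

theorem InCommutant.word {V : CommutingIsometries ι H} {A : H →L[ℂ] H} (hA : V.InCommutant A)
    (l : List ι) (x : H) : A (V.word l x) = V.word l (A x) := by
  induction l with
  | nil => rfl
  | cons k l ih => rw [word_cons, word_cons, hA.apply, ih]

theorem op_adjoint_of_unitary [CompleteSpace H] (V : CommutingIsometries ι H)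
    (hV : ∀ i, IsUnitaryOp (V.op i)) (i : ι) (x : H) :
    V.op i (ContinuousLinearMap.adjoint (V.op i) x) = x := by
  obtain ⟨y, rfl⟩ := (hV i).2 x
  rw [adjoint_apply_self_of_norm (V.norm_op i)]

theorem word_reverse_adjoint [CompleteSpace H] (V : CommutingIsometries ι H)
    (hV : ∀ i, IsUnitaryOp (V.op i)) (l : List ι) (x : H) :
    V.word l.reverse ((l.map fun k => ContinuousLinearMap.adjoint (V.op k)).prod x) = x := by
  induction l with
  | nil => rfl
  | cons k l ih =>
    rw [List.reverse_cons, word_append, List.map_cons, List.prod_cons, mul_apply_eq_comp,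
      word_cons, word_nil, V.op_adjoint_of_unitary hV]
    exact ih

namespace MinimalUnitaryExtension

variable {V : CommutingIsometries ι H} (E : V.MinimalUnitaryExtension)

theorem word_emb (l : List ι) (h : H) : E.family.word l (E.emb h) = E.emb (V.word l h) := by
  induction l with
  | nil => rfl
  | cons k l ih => rw [word_cons, word_cons, ih, E.extends_op]

/-- The pairs `(U_l^* h, U_l^* A h)`: the graph of the extension of `A`, before closure. -/
def extensionGraph (A : H →L[ℂ] H) (hA : V.InCommutant A) :
    Submodule ℂ (E.space × E.space) where
  carrier := {p | ∃ (l : List ι) (h : H),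
    E.family.word l p.1 = E.emb h ∧ E.family.word l p.2 = E.emb (A h)}
  zero_mem' := ⟨[], 0, by simp, by simp⟩
  add_mem' := by
    rintro p q ⟨l, h, h1, h2⟩ ⟨m, k, h3, h4⟩
    refine ⟨l ++ m, V.word m h + V.word l k, ?_, ?_⟩
    · rw [Prod.fst_add, map_add, word_append, word_append, h3, word_comm, h1, word_emb, word_emb,
        map_add]
    · rw [Prod.snd_add, map_add, word_append, word_append, h4, word_comm, h2, word_emb, word_emb,
        map_add, map_add, hA.word, hA.word]
  smul_mem' := by
    rintro c p ⟨l, h, h1, h2⟩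
    refine ⟨l, c • h, ?_, ?_⟩
    · rw [Prod.smul_fst, map_smul, h1, map_smul]
    · rw [Prod.smul_snd, map_smul, h2, map_smul, map_smul]

theorem extensionGraph_op (A : H →L[ℂ] H) (hA : V.InCommutant A) (i : ι)
    {p : E.space × E.space} (hp : p ∈ E.extensionGraph A hA) :
    (E.family.op i p.1, E.family.op i p.2) ∈ E.extensionGraph A hA := by
  obtain ⟨l, h, h1, h2⟩ := hp
  refine ⟨l, V.op i h, ?_, ?_⟩
  · rw [word_op_comm, h1, E.extends_op]
  · rw [word_op_comm, h2, E.extends_op, hA.apply]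

/-- First coordinate on the graph. -/
def graphFst (A : H →L[ℂ] H) (hA : V.InCommutant A) : E.extensionGraph A hA →ₗ[ℂ] E.space :=
  LinearMap.fst ℂ E.space E.space ∘ₗ (E.extensionGraph A hA).subtype

/-- Second coordinate on the graph. -/
def graphSnd (A : H →L[ℂ] H) (hA : V.InCommutant A) : E.extensionGraph A hA →ₗ[ℂ] E.space :=
  LinearMap.snd ℂ E.space E.space ∘ₗ (E.extensionGraph A hA).subtype

theorem graph_dense (A : H →L[ℂ] H) (hA : V.InCommutant A) :
    DenseRange (E.graphFst A hA) := by
  have h1 := Submodule.dense_iff_topologicalClosure_eq_top.2 E.minimal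
  refine h1.mono ?_
  rw [← LinearMap.coe_range, SetLike.coe_subset_coe, Submodule.span_le]
  rintro _ ⟨l, h, rfl⟩
  refine ⟨⟨(_, (l.map fun k => ContinuousLinearMap.adjoint (E.family.op k)).prod
    (E.emb (A h))), l.reverse, h, ?_, ?_⟩, rfl⟩
  · exact E.family.word_reverse_adjoint E.unitary l _
  · exact E.family.word_reverse_adjoint E.unitary l _

theorem graph_norm (A : H →L[ℂ] H) (hA : V.InCommutant A) (p : E.extensionGraph A hA) :
    ‖E.graphSnd A hA p‖ ≤ ‖A‖ * ‖E.graphFst A hA p‖ := by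
  obtain ⟨p, l, h, h1, h2⟩ := p
  change ‖p.2‖ ≤ ‖A‖ * ‖p.1‖
  rw [← E.family.monoid_norm (E.family.word_mem l) p.1,
    ← E.family.monoid_norm (E.family.word_mem l) p.2, h1, h2, E.emb.norm_map, E.emb.norm_map]
  exact A.le_opNorm h

/-- The canonical extension of an operator `A` in the commutant of `V` to the space of a minimal
unitary extension: the unique operator in the commutant of that extension whose restriction to
the original space is `A`. -/
def extend (A : H →L[ℂ] H) (hA : V.InCommutant A) : E.space →L[ℂ] E.space :=
  (E.graphSnd A hA).extendOfNorm (E.graphFst A hA)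

theorem extend_graph (A : H →L[ℂ] H) (hA : V.InCommutant A) (p : E.extensionGraph A hA) :
    E.extend A hA p.1.1 = p.1.2 :=
  LinearMap.extendOfNorm_eq (E.graph_dense A hA) ⟨_, E.graph_norm A hA⟩ p

theorem extend_emb (A : H →L[ℂ] H) (hA : V.InCommutant A) (h : H) :
    E.extend A hA (E.emb h) = E.emb (A h) :=
  E.extend_graph A hA ⟨(E.emb h, E.emb (A h)), [], h, rfl, rfl⟩

theorem norm_extend_le (A : H →L[ℂ] H) (hA : V.InCommutant A) : ‖E.extend A hA‖ ≤ ‖A‖ :=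
  LinearMap.opNorm_extendOfNorm_le (E.graph_dense A hA) (norm_nonneg A) (E.graph_norm A hA)

theorem extend_inCommutant (A : H →L[ℂ] H) (hA : V.InCommutant A) :
    E.family.InCommutant (E.extend A hA) := by
  intro i
  refine ContinuousLinearMap.coeFn_injective ?_
  refine (E.graph_dense A hA).equalizer (ContinuousLinearMap.continuous _)
    (ContinuousLinearMap.continuous _) ?_
  funext p
  change E.extend A hA (E.family.op i p.1.1) = E.family.op i (E.extend A hA p.1.1)
  rw [E.extend_graph A hA p]
  exact E.extend_graph A hA ⟨_, E.extensionGraph_op A hA i p.2⟩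

/-- The extension is determined by the two properties above. -/
theorem extend_unique (A : H →L[ℂ] H) (hA : V.InCommutant A) (B : E.space →L[ℂ] E.space)
    (hB : E.family.InCommutant B) (hBA : ∀ h, B (E.emb h) = E.emb (A h)) :
    B = E.extend A hA := by
  refine ContinuousLinearMap.coeFn_injective ?_
  refine (E.graph_dense A hA).equalizer (ContinuousLinearMap.continuous _)
    (ContinuousLinearMap.continuous _) ?_
  funext p
  change B p.1.1 = E.extend A hA p.1.1
  rw [E.extend_graph A hA p]
  obtain ⟨p, l, h, h1, h2⟩ := p
  have hi : Function.Injective (E.family.word l) := by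
    refine (injective_iff_map_eq_zero _).2 fun x hx => ?_
    rw [← norm_eq_zero, ← E.family.monoid_norm (E.family.word_mem l) x, hx, norm_zero]
  apply hi
  change E.family.word l (B p.1) = E.family.word l p.2
  rw [h2, ← hB.word, h1, hBA]

end MinimalUnitaryExtension

end CommutantExtension

section Defect

variable {E : Type v} [NormedAddCommGroup E] [InnerProductSpace ℂ E] [CompleteSpace E]

/-- The defect operator `D_T = (I - T^* T)^{1/2}` of a contraction `T`. -/
def defectOperator (T : E →L[ℂ] E) : E →L[ℂ] E :=
  CFC.sqrt (1 - ContinuousLinearMap.adjoint T * T)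

/-- The defect space: the closure of the range of the defect operator. -/
def defectSpace (T : E →L[ℂ] E) : Submodule ℂ E :=
  (LinearMap.range (defectOperator T).toLinearMap).topologicalClosure

instance (T : E →L[ℂ] E) : CompleteSpace (defectSpace T) :=
  Submodule.topologicalClosure.completeSpace _

theorem defectOperator_mem (T : E →L[ℂ] E) (x : E) : defectOperator T x ∈ defectSpace T :=
  Submodule.le_topologicalClosure _ ⟨x, rfl⟩

theorem defect_nonneg {T : E →L[ℂ] E} (hT : ‖T‖ ≤ 1) :
    0 ≤ 1 - ContinuousLinearMap.adjoint T * T := by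
  rw [sub_nonneg, ← ContinuousLinearMap.star_eq_adjoint,
    ← CStarAlgebra.norm_le_one_iff_of_nonneg (star T * T) (star_mul_self_nonneg T),
    CStarRing.norm_star_mul_self]
  exact mul_le_one₀ hT (norm_nonneg _) hT

theorem norm_sq_defectOperator {T : E →L[ℂ] E} (hT : ‖T‖ ≤ 1) (x : E) :
    ‖T x‖ ^ 2 + ‖defectOperator T x‖ ^ 2 = ‖x‖ ^ 2 := by
  have h1 : ContinuousLinearMap.adjoint (defectOperator T) = defectOperator T :=
    (IsSelfAdjoint.of_nonneg (CFC.sqrt_nonneg _)).star_eq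
  have h2 : defectOperator T * defectOperator T = 1 - ContinuousLinearMap.adjoint T * T :=
    CFC.sqrt_mul_sqrt_self _ (defect_nonneg hT)
  have h3 : ContinuousLinearMap.adjoint (defectOperator T) ∘L defectOperator T =
      1 - ContinuousLinearMap.adjoint T * T := by rw [h1]; exact h2
  rw [ContinuousLinearMap.apply_norm_sq_eq_inner_adjoint_left (defectOperator T), h3,
    ContinuousLinearMap.apply_norm_sq_eq_inner_adjoint_left T, ← inner_self_eq_norm_sq (𝕜 := ℂ) x,
    ← map_add, ← inner_add_left]
  congr 2
  change ContinuousLinearMap.adjoint T (T x) + (x - ContinuousLinearMap.adjoint T (T x)) = x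
  abel

theorem defectOperator_comm {T U : E →L[ℂ] E} (hU : IsUnitaryOp U) (hTU : T ∘L U = U ∘L T)
    (x : E) : defectOperator T (U x) = U (defectOperator T x) := by
  have h1 : ContinuousLinearMap.adjoint U * U = 1 :=
    (ContinuousLinearMap.norm_map_iff_adjoint_comp_self U).1 hU.1
  have h2 : U * ContinuousLinearMap.adjoint U = 1 := by
    refine ContinuousLinearMap.ext fun x => ?_
    obtain ⟨y, rfl⟩ := hU.2 x
    exact congrArg U (adjoint_apply_self_of_norm hU.1 y)
  have h3 : T * U = U * T := hTU
  have h4 : T * ContinuousLinearMap.adjoint U = ContinuousLinearMap.adjoint U * T := by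
    calc T * ContinuousLinearMap.adjoint U
        = ContinuousLinearMap.adjoint U * (U * T) * ContinuousLinearMap.adjoint U := by
          rw [← mul_assoc, h1, one_mul]
      _ = ContinuousLinearMap.adjoint U * T := by
          rw [← h3, ← mul_assoc, mul_assoc _ U, h2, mul_one]
  have h5 : U * ContinuousLinearMap.adjoint T = ContinuousLinearMap.adjoint T * U := by
    have := congrArg star h4
    rwa [star_mul, star_mul, ← ContinuousLinearMap.star_eq_adjoint, star_star] at this
  have h6 : Commute (1 - ContinuousLinearMap.adjoint T * T) U := by
    refine (Commute.one_left U).sub_left ?_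
    change _ * U = U * _
    rw [mul_assoc, h3, ← mul_assoc, ← h5, mul_assoc]
  exact DFunLike.congr_fun (h6.cfcₙ_nnreal NNReal.sqrt).eq x

theorem mapsTo_defectSpace {T U : E →L[ℂ] E} (hU : IsUnitaryOp U) (hTU : T ∘L U = U ∘L T) :
    ∀ x ∈ defectSpace T, U x ∈ defectSpace T := by
  have h : Set.MapsTo U (LinearMap.range (defectOperator T).toLinearMap : Set E)
      (LinearMap.range (defectOperator T).toLinearMap : Set E) := by
    rintro _ ⟨x, rfl⟩
    exact ⟨U x, defectOperator_comm hU hTU x⟩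
  exact h.closure U.continuous

end Defect

section ModelSpace

theorem memlp_two_iff {D : Type w} [NormedAddCommGroup D] {f : ℕ → D} :
    Memℓp f 2 ↔ Summable fun j => ‖f j‖ ^ 2 := by
  rw [memℓp_gen_iff (by norm_num)]
  simp

theorem lp_two_norm_sq {D : Type w} [NormedAddCommGroup D] (f : lp (fun _ : ℕ => D) 2) : ‖f‖ ^ 2 = ∑' j, ‖f j‖ ^ 2 := by
  simpa using lp.norm_rpow_eq_tsum (p := 2) (by norm_num) f

variable {H : Type v} [NormedAddCommGroup H] [InnerProductSpace ℂ H]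
  {D : Type w} [NormedAddCommGroup D] [InnerProductSpace ℂ D]

/-- The Hilbert space `H ⊕ D ⊕ D ⊕ ⋯`. -/
abbrev ModelSpace (H : Type v) [NormedAddCommGroup H] (D : Type w) [NormedAddCommGroup D] :
    Type (max v w) :=
  WithLp 2 (H × lp (fun _ : ℕ => D) 2)

/-- The sequence `(T d_0, T d_1, …)`, for an isometric operator `T`. -/
def mapSeq (T : D →L[ℂ] D) (hT : ∀ d, ‖T d‖ = ‖d‖) (f : lp (fun _ : ℕ => D) 2) :
    lp (fun _ : ℕ => D) 2 :=
  ⟨fun j => T (f j), memlp_two_iff.2 (by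
    simp only [hT]
    exact memlp_two_iff.1 (lp.memℓp f))⟩

/-- The sequence `(d, d_0, d_1, …)`. -/
def consSeq (d : D) (f : lp (fun _ : ℕ => D) 2) : lp (fun _ : ℕ => D) 2 :=
  ⟨fun j => Nat.casesOn j d fun i => f i, memlp_two_iff.2 (by
    rw [← summable_nat_add_iff 1]
    exact memlp_two_iff.1 (lp.memℓp f))⟩

/-- The operator `h ⊕ d_0 ⊕ d_1 ⊕ ⋯ ↦ V h ⊕ T d_0 ⊕ T d_1 ⊕ ⋯`, for isometric operators `V` and
`T`. -/
def diagonalIsometry (V : H →L[ℂ] H) (hV : ∀ h, ‖V h‖ = ‖h‖) (T : D →L[ℂ] D)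
    (hT : ∀ d, ‖T d‖ = ‖d‖) : ModelSpace H D →ₗᵢ[ℂ] ModelSpace H D where
  toFun x := WithLp.toLp 2 (V x.fst, mapSeq T hT x.snd)
  map_add' x y := by
    apply WithLp.ofLp_injective
    refine Prod.ext (map_add V _ _) ?_
    apply lp.ext; funext j; exact map_add T _ _
  map_smul' c x := by
    apply WithLp.ofLp_injective
    refine Prod.ext (map_smul V _ _) ?_
    apply lp.ext; funext j; exact map_smul T _ _
  norm_map' x := by
    rw [← sq_eq_sq₀ (norm_nonneg _) (norm_nonneg _), WithLp.prod_norm_sq_eq_of_L2,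
      WithLp.prod_norm_sq_eq_of_L2]
    change ‖V x.fst‖ ^ 2 + ‖mapSeq T hT x.snd‖ ^ 2 = _
    rw [hV, lp_two_norm_sq, lp_two_norm_sq]
    congr 2
    funext j
    exact congrArg (· ^ 2) (hT _)

/-- The operator `h ⊕ d_0 ⊕ d_1 ⊕ ⋯ ↦ A h ⊕ R h ⊕ d_0 ⊕ d_1 ⊕ ⋯`, for operators `A` and `R` with
`‖A h‖² + ‖R h‖² = ‖h‖²`. -/
def shiftIsometry (A : H →L[ℂ] H) (R : H →L[ℂ] D) (hAR : ∀ h, ‖A h‖ ^ 2 + ‖R h‖ ^ 2 = ‖h‖ ^ 2) :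
    ModelSpace H D →ₗᵢ[ℂ] ModelSpace H D where
  toFun x := WithLp.toLp 2 (A x.fst, consSeq (R x.fst) x.snd)
  map_add' x y := by
    apply WithLp.ofLp_injective
    refine Prod.ext (map_add A _ _) ?_
    apply lp.ext; funext j
    cases j with
    | zero => exact map_add R _ _
    | succ j => rfl
  map_smul' c x := by
    apply WithLp.ofLp_injective
    refine Prod.ext (map_smul A _ _) ?_
    apply lp.ext; funext j
    cases j with
    | zero => exact map_smul R _ _
    | succ j => rfl
  norm_map' x := by
    rw [← sq_eq_sq₀ (norm_nonneg _) (norm_nonneg _), WithLp.prod_norm_sq_eq_of_L2,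
      WithLp.prod_norm_sq_eq_of_L2]
    change ‖A x.fst‖ ^ 2 + ‖consSeq (R x.fst) x.snd‖ ^ 2 = _
    have h := (memlp_two_iff.1 (lp.memℓp (consSeq (R x.fst) x.snd))).tsum_eq_zero_add
    rw [lp_two_norm_sq, lp_two_norm_sq, h, ← add_assoc]
    exact congrArg (· + _) (hAR x.fst)

end ModelSpace

section Model

variable {n : Ordinal.{u}} {H : Type v} [NormedAddCommGroup H] [InnerProductSpace ℂ H]
  [CompleteSpace H]

/-- The space `D`, the closure of the range of the defect operator of the extension `Ã`. -/
abbrev modelDefectSpace (V : NIsometry n H) (A : H →L[ℂ] H) (hAV : V.InCommutant A) :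
    Submodule ℂ V.minimalUnitaryExtension.space :=
  defectSpace (V.minimalUnitaryExtension.extend A hAV)

/-- The operator `h ↦ D_Ã h` from `H` to the defect space. -/
def modelDefectMap (V : NIsometry n H) (A : H →L[ℂ] H) (hAV : V.InCommutant A) :
    H →L[ℂ] V.modelDefectSpace A hAV :=
  (defectOperator (V.minimalUnitaryExtension.extend A hAV) ∘L
    V.minimalUnitaryExtension.emb.toContinuousLinearMap).codRestrict _
      fun _ => defectOperator_mem _ _

theorem norm_sq_modelDefectMap (V : NIsometry n H) (A : H →L[ℂ] H) (hA : ‖A‖ ≤ 1)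
    (hAV : V.InCommutant A) (h : H) : ‖A h‖ ^ 2 + ‖V.modelDefectMap A hAV h‖ ^ 2 = ‖h‖ ^ 2 := by
  have h1 := norm_sq_defectOperator
    ((V.minimalUnitaryExtension.norm_extend_le A hAV).trans hA) (V.minimalUnitaryExtension.emb h)
  rw [V.minimalUnitaryExtension.extend_emb, LinearIsometry.norm_map, LinearIsometry.norm_map] at h1
  exact h1

/-- The operator `Ṽ_k | D`. -/
def modelRestrict (V : NIsometry n H) (A : H →L[ℂ] H) (hAV : V.InCommutant A) (k : Set.Iio n) :
    V.modelDefectSpace A hAV →L[ℂ] V.modelDefectSpace A hAV :=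
  (V.minimalUnitaryExtension.family.op k).restrict
    (mapsTo_defectSpace (V.minimalUnitaryExtension.unitary k)
      (V.minimalUnitaryExtension.extend_inCommutant A hAV k))

/-- The operators of the model `W_A`: for `k < n`,
`W_k (h ⊕ d_0 ⊕ d_1 ⊕ ⋯) = V_k h ⊕ Ṽ_k d_0 ⊕ Ṽ_k d_1 ⊕ ⋯`, and
`W_n (h ⊕ d_0 ⊕ d_1 ⊕ ⋯) = A h ⊕ D_Ã h ⊕ d_0 ⊕ d_1 ⊕ ⋯`. -/
def modelOp (V : NIsometry n H) (A : H →L[ℂ] H) (hA : ‖A‖ ≤ 1) (hAV : V.InCommutant A)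
    (k : Set.Iio (n + 1)) :
    ModelSpace H (V.modelDefectSpace A hAV) →ₗᵢ[ℂ] ModelSpace H (V.modelDefectSpace A hAV) :=
  open Classical in
  if hk : k.1 < n then
    diagonalIsometry (V.op ⟨k.1, hk⟩) (V.norm_op ⟨k.1, hk⟩) (V.modelRestrict A hAV ⟨k.1, hk⟩)
      fun d => V.minimalUnitaryExtension.family.norm_op ⟨k.1, hk⟩ d
  else
    shiftIsometry A (V.modelDefectMap A hAV) (V.norm_sq_modelDefectMap A hA hAV)

theorem modelOp_diagonal_diagonal (V : NIsometry n H) (A : H →L[ℂ] H) (hAV : V.InCommutant A)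
    (i j : Set.Iio n) (x : ModelSpace H (V.modelDefectSpace A hAV)) :
    diagonalIsometry (V.op i) (V.norm_op i) (V.modelRestrict A hAV i)
        (fun d => V.minimalUnitaryExtension.family.norm_op i d)
        (diagonalIsometry (V.op j) (V.norm_op j) (V.modelRestrict A hAV j)
          (fun d => V.minimalUnitaryExtension.family.norm_op j d) x) =
      diagonalIsometry (V.op j) (V.norm_op j) (V.modelRestrict A hAV j)
        (fun d => V.minimalUnitaryExtension.family.norm_op j d)
        (diagonalIsometry (V.op i) (V.norm_op i) (V.modelRestrict A hAV i)
          (fun d => V.minimalUnitaryExtension.family.norm_op i d) x) := by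
  apply WithLp.ofLp_injective
  refine Prod.ext (DFunLike.congr_fun (V.comm i j) x.fst) ?_
  apply lp.ext; funext m
  exact Subtype.ext (DFunLike.congr_fun (V.minimalUnitaryExtension.family.comm i j) (x.snd m).1)

theorem modelOp_diagonal_shift (V : NIsometry n H) (A : H →L[ℂ] H) (hA : ‖A‖ ≤ 1)
    (hAV : V.InCommutant A) (i : Set.Iio n) (x : ModelSpace H (V.modelDefectSpace A hAV)) :
    diagonalIsometry (V.op i) (V.norm_op i) (V.modelRestrict A hAV i)
        (fun d => V.minimalUnitaryExtension.family.norm_op i d)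
        (shiftIsometry A (V.modelDefectMap A hAV) (V.norm_sq_modelDefectMap A hA hAV) x) =
      shiftIsometry A (V.modelDefectMap A hAV) (V.norm_sq_modelDefectMap A hA hAV)
        (diagonalIsometry (V.op i) (V.norm_op i) (V.modelRestrict A hAV i)
          (fun d => V.minimalUnitaryExtension.family.norm_op i d) x) := by
  apply WithLp.ofLp_injective
  refine Prod.ext (hAV.apply i x.fst).symm ?_
  apply lp.ext; funext m
  cases m with
  | zero =>
    apply Subtype.ext
    change V.minimalUnitaryExtension.family.op i (defectOperator _
      (V.minimalUnitaryExtension.emb x.fst)) =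
        defectOperator _ (V.minimalUnitaryExtension.emb (V.op i x.fst))
    rw [← V.minimalUnitaryExtension.extends_op, defectOperator_comm
      (V.minimalUnitaryExtension.unitary i) (V.minimalUnitaryExtension.extend_inCommutant A hAV i)]
  | succ m => rfl

/-- The model `W_A`: the `(n + 1)`-isometry on `H ⊕ D ⊕ D ⊕ ⋯` associated to an `n`-isometry `V`
on `H` and a contraction `A` in the commutant of `V`. -/
def model (V : NIsometry n H) (A : H →L[ℂ] H) (hA : ‖A‖ ≤ 1) (hAV : V.InCommutant A) :
    NIsometry (n + 1) (ModelSpace H (V.modelDefectSpace A hAV)) where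
  op k := (V.modelOp A hA hAV k).toContinuousLinearMap
  norm_op k x := (V.modelOp A hA hAV k).norm_map x
  comm i j := by
    refine ContinuousLinearMap.ext fun x => ?_
    change V.modelOp A hA hAV i (V.modelOp A hA hAV j x) =
      V.modelOp A hA hAV j (V.modelOp A hA hAV i x)
    unfold modelOp
    split_ifs with hi hj hj
    · exact V.modelOp_diagonal_diagonal A hAV _ _ x
    · exact V.modelOp_diagonal_shift A hA hAV _ x
    · exact (V.modelOp_diagonal_shift A hA hAV _ x).symm
    · rfl

end Model

end CommutingIsometries

end

/-!
Let `N` be the largest subspace with `N ⊆ W_k N` for all `k < n`, the unitary summand in the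
von Neumann–Wold decomposition of `(W_k)_{k<n}`. It is invariant under `W_n`, which therefore has
an upper triangular matrix along `N ⊕ Nᗮ`, with lower right corner a contraction `A` on `Nᗮ` and
off-diagonal entry `X : Nᗮ → N`. Since the `W_k`, `k < n`, are invertible on `N`, the intertwiner
`X` extends to the minimal unitary extension of `W_k | Nᗮ`, and `‖X h‖² = ‖h‖² - ‖A h‖²` turns the
extension into an isometric copy of the defect space `𝔇` in `N`, wandering for `W_n | N`. This
copy, its translates by powers of `W_n`, and `Nᗮ` span a copy of the model `W_A`. Its orthogonal
complement reduces `W` and the `W_k`, `k < n`, are unitary there, so it vanishes when `W` is pure.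

Conversely, let `M` reduce the model of a completely nonunitary family, with the first `n`
operators unitary on `M`. The projection of `M` to `H` lies in the unitary part of the family, so
it is zero. As `W_n^* M ⊆ M` and the first coordinate of `W_n^* (0 ⊕ d_0 ⊕ d_1 ⊕ ⋯)` is
`P_H D_Ã d_0`, the entries `d_0` of vectors of `M` are orthogonal to `D_Ã H`; they form a space
invariant under `Ṽ`, so they are orthogonal to `𝔇` too. The other entries vanish because `W_n^*`
shifts them down.
-/

noncomputable section

open scoped InnerProductSpace ENNReal

section Isometry

variable {E : Type u} [NormedAddCommGroup E] [InnerProductSpace ℂ E] {T : E →L[ℂ] E}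

theorem inner_map_map_of_norm (hT : ∀ x, ‖T x‖ = ‖x‖) (x y : E) : ⟪T x, T y⟫_ℂ = ⟪x, y⟫_ℂ :=
  (LinearMap.norm_map_iff_inner_map_map T).1 hT x y

theorem mapsTo_orthogonal_of_surjOn (hT : ∀ x, ‖T x‖ = ‖x‖) {M : Submodule ℂ E}
    (hM : Set.SurjOn T M M) : Set.MapsTo T Mᗮ (Mᗮ : Submodule ℂ E) := by
  intro x hx
  refine (Submodule.mem_orthogonal _ _).2 fun y hy => ?_
  obtain ⟨z, hz, rfl⟩ := hM hy
  rw [inner_map_map_of_norm hT]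
  exact Submodule.inner_right_of_mem_orthogonal hz hx

theorem mem_orthogonal_of_map_mem_orthogonal (hT : ∀ x, ‖T x‖ = ‖x‖) {M : Submodule ℂ E}
    (hM : Set.MapsTo T M M) {x : E} (hx : T x ∈ Mᗮ) : x ∈ Mᗮ := by
  refine (Submodule.mem_orthogonal _ _).2 fun y hy => ?_
  rw [← inner_map_map_of_norm hT]
  exact Submodule.inner_right_of_mem_orthogonal (hM hy) hx

theorem surjOn_topologicalClosure_of_norm [CompleteSpace E] (hT : ∀ x, ‖T x‖ = ‖x‖)
    {M : Submodule ℂ E} (hM : Set.SurjOn T M M) :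
    Set.SurjOn T M.topologicalClosure M.topologicalClosure := by
  have hclosed : IsClosed (T '' (M.topologicalClosure : Set E)) :=
    (AddMonoidHomClass.isometry_of_norm T hT).isClosedEmbedding.isClosedMap _
      M.isClosed_topologicalClosure
  exact closure_minimal (hM.trans (Set.image_mono M.le_topologicalClosure)) hclosed

variable {D : Type v} [NormedAddCommGroup D] [InnerProductSpace ℂ D]
  {K : Type w} [NormedAddCommGroup K] [InnerProductSpace ℂ K]

theorem exists_linearIsometry_comp_eq [CompleteSpace K] {R : E →L[ℂ] D} (hR : DenseRange R)
    {Y : E →L[ℂ] K} (hY : ∀ x, ‖Y x‖ = ‖R x‖) : ∃ Φ : D →ₗᵢ[ℂ] K, ∀ x, Φ (R x) = Y x := by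
  have hext : ∀ x, Y.toLinearMap.extendOfNorm R.toLinearMap (R x) = Y x :=
    LinearMap.extendOfNorm_eq hR ⟨1, fun x => by rw [one_mul]; exact (hY x).le⟩
  refine ⟨⟨(Y.toLinearMap.extendOfNorm R.toLinearMap).toLinearMap, fun d => ?_⟩, hext⟩
  refine hR.induction_on d (isClosed_eq (ContinuousLinearMap.continuous _).norm continuous_norm)
    fun x => ?_
  exact (congrArg norm (hext x)).trans (hY x)

theorem orthogonalFamily_pow_comp (S : K →ₗᵢ[ℂ] K) (Φ : D →ₗᵢ[ℂ] K)
    (hΦ : ∀ j d e, ⟪Φ d, (S ^ (j + 1)) (Φ e)⟫_ℂ = 0) :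
    OrthogonalFamily ℂ (fun _ : ℕ => D) fun j => (S ^ j).comp Φ := by
  have hlt (i k : ℕ) (d e : D) : ⟪(S ^ i) (Φ d), (S ^ (i + k + 1)) (Φ e)⟫_ℂ = 0 := by
    rw [add_assoc, pow_add, LinearIsometry.coe_mul, Function.comp_apply,
      LinearIsometry.inner_map_map, hΦ]
  intro i j hij d e
  rcases lt_or_gt_of_ne hij with h | h
  · obtain ⟨k, rfl⟩ := Nat.exists_eq_add_of_lt h
    exact hlt i k d e
  · obtain ⟨k, rfl⟩ := Nat.exists_eq_add_of_lt h
    exact inner_eq_zero_symm.1 (hlt j k e d)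

/-- The isometry `x ⊕ d ↦ J x + L d`, for isometries `J` and `L` with orthogonal ranges. -/
def sumIsometry (J : E →ₗᵢ[ℂ] K) (L : D →ₗᵢ[ℂ] K) (hJL : ∀ x d, ⟪J x, L d⟫_ℂ = 0) :
    WithLp 2 (E × D) →ₗᵢ[ℂ] K where
  toLinearMap := J.toLinearMap.coprod L.toLinearMap ∘ₗ (WithLp.linearEquiv 2 ℂ (E × D)).toLinearMap
  norm_map' x := by
    change ‖J x.fst + L x.snd‖ = _
    rw [← sq_eq_sq₀ (norm_nonneg _) (norm_nonneg _), WithLp.prod_norm_sq_eq_of_L2, sq, sq, sq,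
      norm_add_sq_eq_norm_sq_add_norm_sq_of_inner_eq_zero _ _ (hJL _ _), J.norm_map, L.norm_map]

theorem range_sumIsometry (J : E →ₗᵢ[ℂ] K) (L : D →ₗᵢ[ℂ] K) (hJL : ∀ x d, ⟪J x, L d⟫_ℂ = 0) :
    LinearMap.range (sumIsometry J L hJL).toLinearMap =
      LinearMap.range J.toLinearMap ⊔ LinearMap.range L.toLinearMap := by
  rw [← LinearMap.range_coprod]
  exact LinearEquiv.range_comp _ _

end Isometry

namespace CommutingIsometries

section Intertwiners

variable {ι : Type u} {H : Type v} [NormedAddCommGroup H] [InnerProductSpace ℂ H]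
  {K : Type w} [NormedAddCommGroup K] [InnerProductSpace ℂ K]

/-- The relation `X V_i = W_i X` for all `i`, for families on possibly different spaces;
`InCommutant` is the case `V = W`. -/
def Intertwines (V : CommutingIsometries ι H) (W : CommutingIsometries ι K) (X : H →L[ℂ] K) :
    Prop :=
  ∀ i x, X (V.op i x) = W.op i (X x)

variable {V : CommutingIsometries ι H} {W : CommutingIsometries ι K} {X : H →L[ℂ] K}

theorem InCommutant.intertwines {A : H →L[ℂ] H} (hA : V.InCommutant A) : V.Intertwines V A :=
  hA.apply

theorem Intertwines.word (hX : V.Intertwines W X) (l : List ι) (x : H) :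
    X (V.word l x) = W.word l (X x) := by
  induction l with
  | nil => rfl
  | cons i l ih => rw [word_cons, word_cons, hX, ih]

theorem Intertwines.comp {L : Type*} [NormedAddCommGroup L] [InnerProductSpace ℂ L]
    {Z : CommutingIsometries ι L} {Y : K →L[ℂ] L} (hY : W.Intertwines Z Y)
    (hX : V.Intertwines W X) : V.Intertwines Z (Y ∘L X) :=
  fun i x => (congrArg Y (hX i x)).trans (hY i (X x))

end Intertwiners

section UnitaryPart

variable {ι : Type u} {H : Type v} [NormedAddCommGroup H] [InnerProductSpace ℂ H]
  {K : Type w} [NormedAddCommGroup K] [InnerProductSpace ℂ K]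

/-- The unitary summand of the von Neumann–Wold decomposition of a commuting family, encoded as the
largest subspace `M` with `M ⊆ V_i M` for all `i`. -/
def unitaryPart (V : CommutingIsometries ι H) : Submodule ℂ H :=
  sSup {M | ∀ i, Set.SurjOn (V.op i) M M}

theorem le_unitaryPart {V : CommutingIsometries ι H} {M : Submodule ℂ H}
    (hM : ∀ i, Set.SurjOn (V.op i) M M) : M ≤ V.unitaryPart :=
  le_sSup hM

theorem surjOn_unitaryPart (V : CommutingIsometries ι H) (i : ι) :
    Set.SurjOn (V.op i) V.unitaryPart V.unitaryPart := by
  change V.unitaryPart ≤ V.unitaryPart.map (V.op i).toLinearMap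
  exact sSup_le fun M hM => (hM i : M ≤ M.map (V.op i).toLinearMap).trans
    (Submodule.map_mono (le_unitaryPart hM))

theorem surjOn_word_unitaryPart (V : CommutingIsometries ι H) (l : List ι) :
    Set.SurjOn (V.word l) V.unitaryPart V.unitaryPart := by
  induction l with
  | nil => exact Set.surjOn_id _
  | cons i l ih => exact (V.surjOn_unitaryPart i).comp ih

theorem unitaryPart_eq_top {V : CommutingIsometries ι H} (hV : ∀ i, IsUnitaryOp (V.op i)) :
    V.unitaryPart = ⊤ :=
  top_le_iff.1 (le_unitaryPart fun i => Set.surjOn_univ.2 (hV i).2)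

theorem isClosed_unitaryPart [CompleteSpace H] (V : CommutingIsometries ι H) :
    IsClosed (V.unitaryPart : Set H) :=
  isClosed_of_closure_subset (le_unitaryPart fun i =>
    surjOn_topologicalClosure_of_norm (V.norm_op i) (V.surjOn_unitaryPart i))

theorem Intertwines.map_mem_unitaryPart {V : CommutingIsometries ι H} {W : CommutingIsometries ι K}
    {X : H →L[ℂ] K} (hX : V.Intertwines W X) {x : H} (hx : x ∈ V.unitaryPart) :
    X x ∈ W.unitaryPart := by
  have hsurj (i : ι) : Set.SurjOn (W.op i) (V.unitaryPart.map X.toLinearMap)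
      (V.unitaryPart.map X.toLinearMap) := by
    rintro _ ⟨y, hy, rfl⟩
    obtain ⟨z, hz, rfl⟩ := V.surjOn_unitaryPart i hy
    exact ⟨X z, ⟨z, hz, rfl⟩, (hX i z).symm⟩
  exact le_unitaryPart hsurj ⟨x, hx, rfl⟩

theorem op_mem_unitaryPart (V : CommutingIsometries ι H) (i : ι) {x : H}
    (hx : x ∈ V.unitaryPart) : V.op i x ∈ V.unitaryPart :=
  (InCommutant.intertwines (V.comm i)).map_mem_unitaryPart hx

theorem isReducing_unitaryPart [CompleteSpace H] (V : CommutingIsometries ι H) :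
    V.IsReducing V.unitaryPart where
  isClosed := V.isClosed_unitaryPart
  invariant i _ hx := V.op_mem_unitaryPart i hx
  invariant_orthogonal i :=
    mapsTo_orthogonal_of_surjOn (V.norm_op i) (V.surjOn_unitaryPart i)

theorem restrict_isUnitaryOn_iff (V : CommutingIsometries ι H) (M : Submodule ℂ H)
    (hM : V.IsInvariant M) (J : Set ι) :
    (V.restrict M hM).IsUnitaryOn J ↔ ∀ j ∈ J, Set.SurjOn (V.op j) M M := by
  refine forall₂_congr fun j _ => ⟨fun h => (hM j).restrict_surjective_iff.1 h.2,
    fun h => ⟨(V.restrict M hM).norm_op j, (hM j).restrict_surjective_iff.2 h⟩⟩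

theorem isCompletelyNonunitary_iff [CompleteSpace H] (V : CommutingIsometries ι H) :
    V.IsCompletelyNonunitary ↔ V.unitaryPart = ⊥ := by
  constructor
  · intro h
    refine h _ V.isReducing_unitaryPart ?_
    rw [restrict_isUnitaryOn_iff]
    exact fun i _ => V.surjOn_unitaryPart i
  · intro h M hM hu
    rw [restrict_isUnitaryOn_iff] at hu
    exact le_bot_iff.1 (h ▸ le_unitaryPart fun i => hu i trivial)

variable [CompleteSpace H]

instance (V : CommutingIsometries ι H) : CompleteSpace V.unitaryPart :=
  V.isClosed_unitaryPart.completeSpace_coe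

/-- The completely nonunitary summand of the von Neumann–Wold decomposition. -/
def nonunitaryPart (V : CommutingIsometries ι H) :
    CommutingIsometries ι (V.unitaryPartᗮ : Submodule ℂ H) :=
  V.restrict _ V.isReducing_unitaryPart.invariant_orthogonal

theorem intertwines_subtypeL_nonunitaryPart (V : CommutingIsometries ι H) :
    V.nonunitaryPart.Intertwines V V.unitaryPartᗮ.subtypeL :=
  fun _ _ => rfl

theorem isCompletelyNonunitary_nonunitaryPart (V : CommutingIsometries ι H) :
    V.nonunitaryPart.IsCompletelyNonunitary := by
  rw [isCompletelyNonunitary_iff, eq_bot_iff]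
  intro x hx
  have hx' : (x : H) ∈ V.unitaryPart :=
    V.intertwines_subtypeL_nonunitaryPart.map_mem_unitaryPart hx
  exact Subtype.ext (inner_self_eq_zero.1 (Submodule.inner_right_of_mem_orthogonal hx' x.2))

end UnitaryPart

section Reducing

variable {ι : Type u} {H : Type v} [NormedAddCommGroup H] [InnerProductSpace ℂ H]

theorem IsReducing.orthogonal {V : CommutingIsometries ι H} {M : Submodule ℂ H}
    [M.HasOrthogonalProjection] (hM : V.IsReducing M) : V.IsReducing Mᗮ :=
  ⟨M.isClosed_orthogonal, hM.invariant_orthogonal, by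
    rw [M.orthogonal_orthogonal]; exact hM.invariant⟩

theorem IsReducing.inCommutant_starProjection {V : CommutingIsometries ι H} {M : Submodule ℂ H}
    [M.HasOrthogonalProjection] (hM : V.IsReducing M) : V.InCommutant M.starProjection := by
  refine fun i => ContinuousLinearMap.ext fun x => ?_
  refine Submodule.eq_starProjection_of_mem_orthogonal
    (hM.invariant i (M.starProjection_apply_mem x)) ?_
  change V.op i x - V.op i (M.starProjection x) ∈ Mᗮ
  rw [← map_sub]
  exact hM.invariant_orthogonal i (M.sub_starProjection_mem_orthogonal x)

theorem IsReducing.adjoint_mem [CompleteSpace H] {V : CommutingIsometries ι H} {M : Submodule ℂ H}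
    (hM : V.IsReducing M) (i : ι) {x : H} (hx : x ∈ M) :
    ContinuousLinearMap.adjoint (V.op i) x ∈ M := by
  have := hM.isClosed.completeSpace_coe
  rw [← M.orthogonal_orthogonal, Submodule.mem_orthogonal]
  intro y hy
  rw [ContinuousLinearMap.adjoint_inner_right]
  exact Submodule.inner_left_of_mem_orthogonal hx (hM.invariant_orthogonal i hy)

end Reducing

section UnitaryEquivalence

variable {ι : Type u} {H : Type v} [NormedAddCommGroup H] [InnerProductSpace ℂ H]
  {K : Type w} [NormedAddCommGroup K] [InnerProductSpace ℂ K]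
  {V : CommutingIsometries ι H} {W : CommutingIsometries ι K}

theorem UnitarilyEquivalent.symm (h : V.UnitarilyEquivalent W) : W.UnitarilyEquivalent V := by
  obtain ⟨Φ, hΦ⟩ := h
  exact ⟨Φ.symm, fun i x => by rw [Φ.symm_apply_eq, hΦ, Φ.apply_symm_apply]⟩

theorem UnitarilyEquivalent.isPure (h : V.UnitarilyEquivalent W) {J : Set ι} (hW : W.IsPure J) :
    V.IsPure J := by
  obtain ⟨Φ, hΦ⟩ := h
  intro M hM hu
  rw [restrict_isUnitaryOn_iff] at hu
  have hmaps {L : Submodule ℂ H} (hL : V.IsInvariant L) :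
      W.IsInvariant (L.map (Φ.toLinearEquiv : H →ₗ[ℂ] K)) := by
    rintro i _ ⟨x, hx, rfl⟩
    exact ⟨V.op i x, hL i hx, hΦ i x⟩
  have hred : W.IsReducing (M.map (Φ.toLinearEquiv : H →ₗ[ℂ] K)) :=
    ⟨Φ.toHomeomorph.isClosedMap _ hM.isClosed, hmaps hM.invariant,
      M.map_orthogonal_equiv Φ ▸ hmaps hM.invariant_orthogonal⟩
  refine Submodule.map_eq_bot_iff.1 (hW _ hred ?_)
  rw [restrict_isUnitaryOn_iff]
  rintro j hj _ ⟨_, hx, rfl⟩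
  obtain ⟨y, hy, rfl⟩ := hu j hj hx
  exact ⟨Φ y, ⟨y, hy, rfl⟩, (hΦ j y).symm⟩

end UnitaryEquivalence

section Defect

variable {E : Type v} [NormedAddCommGroup E] [InnerProductSpace ℂ E] [CompleteSpace E]

/-- The defect operator, as an operator into the defect space. -/
def defectMap (T : E →L[ℂ] E) : E →L[ℂ] defectSpace T :=
  (defectOperator T).codRestrict _ (defectOperator_mem T)

theorem denseRange_defectMap (T : E →L[ℂ] E) : DenseRange (defectMap T) := by
  intro d
  rw [Topology.IsInducing.subtypeVal.closure_eq_preimage_closure_image, ← Set.range_comp]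
  exact d.2

variable {ι : Type u} {U : CommutingIsometries ι E} {T : E →L[ℂ] E}

/-- The restriction of a unitary family `U` to the defect space of an operator commuting with
it. -/
def defectFamily (hU : ∀ i, IsUnitaryOp (U.op i)) (hT : U.InCommutant T) :
    CommutingIsometries ι (defectSpace T) :=
  U.restrict (defectSpace T) fun i => mapsTo_defectSpace (hU i) (hT i)

theorem intertwines_defectMap (hU : ∀ i, IsUnitaryOp (U.op i)) (hT : U.InCommutant T) :
    U.Intertwines (defectFamily hU hT) (defectMap T) :=
  fun i x => Subtype.ext (defectOperator_comm (hU i) (hT i) x)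

theorem unitaryPart_defectFamily (hU : ∀ i, IsUnitaryOp (U.op i)) (hT : U.InCommutant T) :
    (defectFamily hU hT).unitaryPart = ⊤ := by
  refine top_le_iff.1 fun d _ => ?_
  refine (denseRange_defectMap T).induction_on d (isClosed_unitaryPart _) fun x => ?_
  refine (intertwines_defectMap hU hT).map_mem_unitaryPart ?_
  rw [unitaryPart_eq_top hU]
  trivial

theorem surjective_defectFamily (hU : ∀ i, IsUnitaryOp (U.op i)) (hT : U.InCommutant T) (i : ι) :
    Function.Surjective ((defectFamily hU hT).op i) := by
  have h := (defectFamily hU hT).surjOn_unitaryPart i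
  rwa [unitaryPart_defectFamily, Submodule.top_coe, Set.surjOn_univ] at h

end Defect

section Extension

variable {ι : Type u} {H : Type v} [NormedAddCommGroup H] [InnerProductSpace ℂ H]
  {K : Type w} [NormedAddCommGroup K] [InnerProductSpace ℂ K]
  {V : CommutingIsometries ι H}

theorem MinimalUnitaryExtension.dense_word_mem (E : V.MinimalUnitaryExtension) :
    Dense {x : E.space | ∃ (l : List ι) (h : H), E.family.word l x = E.emb h} := by
  have hzero : V.InCommutant (0 : H →L[ℂ] H) := fun i => by ext; simp
  refine (E.graph_dense 0 hzero).mono ?_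
  rintro _ ⟨⟨p, l, h, hp, -⟩, rfl⟩
  exact ⟨l, h, hp⟩

theorem MinimalUnitaryExtension.induction_on (E : V.MinimalUnitaryExtension)
    {p : E.space → Prop} (x : E.space) (hclosed : IsClosed {x | p x})
    (hemb : ∀ h, p (E.emb h)) (hop : ∀ i x, p (E.family.op i x) → p x) : p x := by
  have hword (l : List ι) : ∀ x, p (E.family.word l x) → p x := by
    induction l with
    | nil => exact fun _ hx => hx
    | cons i l ih => exact fun x hx => ih x (hop i _ hx)
  refine E.dense_word_mem.induction ?_ hclosed x
  rintro x ⟨l, h, hx⟩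
  exact hword l x (hx ▸ hemb h)

theorem MinimalUnitaryExtension.map_defectSpace_mem_orthogonal (E : V.MinimalUnitaryExtension)
    {T : E.space →L[ℂ] E.space} (hT : E.family.InCommutant T) {W : CommutingIsometries ι K}
    {Φ : defectSpace T →L[ℂ] K} (hΦ : (defectFamily E.unitary hT).Intertwines W Φ)
    {M : Submodule ℂ K} (hM : W.IsInvariant M) (hΦM : ∀ h, Φ (defectMap T (E.emb h)) ∈ Mᗮ)
    (d : defectSpace T) : Φ d ∈ Mᗮ := by
  refine (denseRange_defectMap T).induction_on d (M.isClosed_orthogonal.preimage Φ.continuous)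
    fun x => ?_
  have hclosed : IsClosed {x | Φ (defectMap T x) ∈ Mᗮ} :=
    M.isClosed_orthogonal.preimage (Φ.continuous.comp (defectMap T).continuous)
  refine E.induction_on x hclosed hΦM fun i x hx => ?_
  rw [intertwines_defectMap E.unitary hT, hΦ] at hx
  exact mem_orthogonal_of_map_mem_orthogonal (W.norm_op i) (hM i) hx

end Extension

section Indices

variable {n : Ordinal.{u}} {K : Type v} [NormedAddCommGroup K] [InnerProductSpace ℂ K]

/-- The index `k < n`, as an index of an `(n + 1)`-isometry. -/
def castIndex (k : Set.Iio n) : Set.Iio (n + 1) :=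
  ⟨k.1, Set.mem_Iio.2 ((Set.mem_Iio.1 k.2).trans (Order.lt_add_one_iff.2 le_rfl))⟩

/-- The index `n` of an `(n + 1)`-isometry. -/
def lastIndex (n : Ordinal.{u}) : Set.Iio (n + 1) :=
  ⟨n, Set.mem_Iio.2 (Order.lt_add_one_iff.2 le_rfl)⟩

theorem forall_index_iff {p : Set.Iio (n + 1) → Prop} :
    (∀ k, p k) ↔ (∀ k, p (castIndex k)) ∧ p (lastIndex n) := by
  refine ⟨fun h => ⟨fun k => h _, h _⟩, fun h k => ?_⟩
  rcases (Order.lt_add_one_iff.1 (Set.mem_Iio.1 k.2)).lt_or_eq with hk | hk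
  · exact h.1 ⟨k.1, hk⟩
  · obtain rfl : k = lastIndex n := Subtype.ext hk
    exact h.2

/-- The `n`-isometry formed by the operators of index `k < n` of an `(n + 1)`-isometry. -/
def initial (W : NIsometry (n + 1) K) : NIsometry n K where
  op k := W.op (castIndex k)
  norm_op _ := W.norm_op _
  comm _ _ := W.comm _ _

/-- The operator of index `n` of an `(n + 1)`-isometry, bundled as a linear isometry. -/
def last (W : NIsometry (n + 1) K) : K →ₗᵢ[ℂ] K :=
  ⟨(W.op (lastIndex n)).toLinearMap, W.norm_op _⟩

theorem intertwines_last (W : NIsometry (n + 1) K) :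
    W.initial.Intertwines W.initial W.last.toContinuousLinearMap :=
  InCommutant.intertwines fun _ => W.comm _ _

theorem isInvariant_iff (W : NIsometry (n + 1) K) (M : Submodule ℂ K) :
    W.IsInvariant M ↔ W.initial.IsInvariant M ∧ Set.MapsTo W.last M M :=
  forall_index_iff

theorem isPure_initial_iff (W : NIsometry (n + 1) K) :
    W.IsPure {k : Set.Iio (n + 1) | k.1 < n} ↔ ∀ M : Submodule ℂ K, W.IsReducing M →
      (∀ k, Set.SurjOn (W.initial.op k) M M) → M = ⊥ := by
  refine forall₂_congr fun M hM => ?_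
  rw [restrict_isUnitaryOn_iff]
  exact imp_congr_left ⟨fun h k => h (castIndex k) k.2, fun h j hj => h ⟨j.1, hj⟩⟩

end Indices

section Shift

variable {H : Type v} [NormedAddCommGroup H] {D : Type w} [NormedAddCommGroup D]

theorem modelSpace_ext {x y : ModelSpace H D} (hfst : x.fst = y.fst)
    (hsnd : ∀ j, x.snd j = y.snd j) : x = y :=
  WithLp.ofLp_injective _ (Prod.ext hfst (lp.ext (funext hsnd)))

variable [InnerProductSpace ℂ H] [InnerProductSpace ℂ D]

theorem inner_toLp_zero (x : ModelSpace H D) (h : H) :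
    ⟪x, WithLp.toLp 2 (h, 0)⟫_ℂ = ⟪x.fst, h⟫_ℂ :=
  (WithLp.prod_inner_apply _ _).trans (by simp)

theorem inner_toLp_single (x : ModelSpace H D) (h : H) (j : ℕ) (d : D) :
    ⟪x, WithLp.toLp 2 (h, lp.single 2 j d)⟫_ℂ = ⟪x.fst, h⟫_ℂ + ⟪x.snd j, d⟫_ℂ :=
  (WithLp.prod_inner_apply _ _).trans
    (congrArg (⟪x.fst, h⟫_ℂ + ·) (lp.inner_single_right j d x.snd))

variable {A : H →L[ℂ] H} {R : H →L[ℂ] D} (hAR : ∀ h, ‖A h‖ ^ 2 + ‖R h‖ ^ 2 = ‖h‖ ^ 2)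

theorem shiftIsometry_toLp_zero (h : H) : shiftIsometry A R hAR (WithLp.toLp 2 (h, 0)) =
    WithLp.toLp 2 (A h, lp.single 2 0 (R h)) := by
  refine modelSpace_ext rfl fun j => ?_
  cases j with
  | zero => exact (Pi.single_eq_same (M := fun _ : ℕ => D) 0 (R h)).symm
  | succ j => exact (Pi.single_eq_of_ne (M := fun _ : ℕ => D) j.succ_ne_zero (R h)).symm

theorem shiftIsometry_toLp_single (j : ℕ) (d : D) :
    shiftIsometry A R hAR (WithLp.toLp 2 (0, lp.single 2 j d)) =
      WithLp.toLp 2 (0, lp.single 2 (j + 1) d) := by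
  refine modelSpace_ext (map_zero A) fun i => ?_
  cases i with
  | zero =>
    exact (map_zero R).trans
      (Pi.single_eq_of_ne (M := fun _ : ℕ => D) j.succ_ne_zero.symm d).symm
  | succ i =>
    change (Pi.single j d : ℕ → D) i = (Pi.single (j + 1) d : ℕ → D) (i + 1)
    simp [Pi.single_apply]

variable [CompleteSpace H] [CompleteSpace D]

theorem adjoint_shiftIsometry_fst (x : ModelSpace H D) :
    (ContinuousLinearMap.adjoint (shiftIsometry A R hAR).toContinuousLinearMap x).fst =
      ContinuousLinearMap.adjoint A x.fst + ContinuousLinearMap.adjoint R (x.snd 0) := by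
  refine ext_inner_right ℂ fun h => ?_
  rw [← inner_toLp_zero, ContinuousLinearMap.adjoint_inner_left,
    LinearIsometry.coe_toContinuousLinearMap, shiftIsometry_toLp_zero, inner_toLp_single,
    inner_add_left, ContinuousLinearMap.adjoint_inner_left, ContinuousLinearMap.adjoint_inner_left]

theorem adjoint_shiftIsometry_snd (x : ModelSpace H D) (j : ℕ) :
    (ContinuousLinearMap.adjoint (shiftIsometry A R hAR).toContinuousLinearMap x).snd j =
      x.snd (j + 1) := by
  refine ext_inner_right ℂ fun d => ?_
  have h := ContinuousLinearMap.adjoint_inner_left (shiftIsometry A R hAR).toContinuousLinearMap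
    (WithLp.toLp 2 (0, lp.single 2 j d)) x
  rw [LinearIsometry.coe_toContinuousLinearMap, shiftIsometry_toLp_single, inner_toLp_single,
    inner_toLp_single, inner_zero_right, inner_zero_right, zero_add, zero_add] at h
  exact h

end Shift

section Model

variable {n : Ordinal.{u}} {H : Type v} [NormedAddCommGroup H] [InnerProductSpace ℂ H]
  [CompleteSpace H] (V : NIsometry n H) {A : H →L[ℂ] H} (hA : ‖A‖ ≤ 1) (hAV : V.InCommutant A)

/-- The restriction of the minimal unitary extension to `𝔇`, acting on each `d_j` in the model. -/
abbrev modelDefectFamily : NIsometry n (V.modelDefectSpace A hAV) :=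
  defectFamily V.minimalUnitaryExtension.unitary
    (V.minimalUnitaryExtension.extend_inCommutant A hAV)

theorem model_initial_op (k : Set.Iio n) : (V.model A hA hAV).initial.op k =
    (diagonalIsometry (V.op k) (V.norm_op k) ((V.modelDefectFamily hAV).op k)
      ((V.modelDefectFamily hAV).norm_op k)).toContinuousLinearMap := by
  have hk : (castIndex k).1 < n := k.2
  change (V.modelOp A hA hAV (castIndex k)).toContinuousLinearMap = _
  rw [modelOp, dif_pos hk]
  rfl

theorem model_last : (V.model A hA hAV).last =
    shiftIsometry A (V.modelDefectMap A hAV) (V.norm_sq_modelDefectMap A hA hAV) := by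
  have hk : ¬ (lastIndex n).1 < n := lt_irrefl n
  change V.modelOp A hA hAV (lastIndex n) = _
  rw [modelOp, dif_neg hk]

/-- The coordinate `h ⊕ d_0 ⊕ d_1 ⊕ ⋯ ↦ d_j`. -/
def defectCoord (j : ℕ) :
    ModelSpace H (V.modelDefectSpace A hAV) →L[ℂ] V.modelDefectSpace A hAV :=
  lp.evalCLM ℂ _ 2 j ∘L WithLp.sndL 2 ℂ _ _

theorem intertwines_fst : (V.model A hA hAV).initial.Intertwines V (WithLp.fstL 2 ℂ _ _) := by
  intro k x
  rw [model_initial_op]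
  rfl

theorem intertwines_defectCoord (j : ℕ) : (V.model A hA hAV).initial.Intertwines
    (V.modelDefectFamily hAV) (V.defectCoord hAV j) := by
  intro k x
  rw [model_initial_op]
  rfl

theorem snd_eq_zero_of_isReducing {M : Submodule ℂ (ModelSpace H (V.modelDefectSpace A hAV))}
    (hM : (V.model A hA hAV).IsReducing M) (hfst : ∀ x ∈ M, x.fst = 0) (j : ℕ) :
    ∀ x ∈ M, x.snd j = 0 := by
  have hS := V.norm_sq_modelDefectMap A hA hAV
  have hadjoint {x} (hx : x ∈ M) : ContinuousLinearMap.adjoint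
      (shiftIsometry A (V.modelDefectMap A hAV) hS).toContinuousLinearMap x ∈ M := by
    rw [← V.model_last hA hAV]
    exact hM.adjoint_mem (lastIndex n) hx
  induction j with
  | zero =>
    intro x hx
    let M₀ := M.map (V.defectCoord hAV 0).toLinearMap
    have hinvariant : (V.modelDefectFamily hAV).IsInvariant M₀ := by
      rintro k _ ⟨y, hy, rfl⟩
      exact ⟨_, hM.invariant (castIndex k) hy, V.intertwines_defectCoord hA hAV 0 k y⟩
    have horthogonal (h : H) : V.modelDefectMap A hAV h ∈ M₀ᗮ := by
      refine (Submodule.mem_orthogonal _ _).2 ?_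
      rintro _ ⟨y, hy, rfl⟩
      have hfst_adjoint := hfst _ (hadjoint hy)
      rw [adjoint_shiftIsometry_fst, hfst y hy, map_zero, zero_add] at hfst_adjoint
      change ⟪y.snd 0, V.modelDefectMap A hAV h⟫_ℂ = 0
      rw [← ContinuousLinearMap.adjoint_inner_left, hfst_adjoint, inner_zero_left]
    have hmem : x.snd 0 ∈ M₀ᗮ := V.minimalUnitaryExtension.map_defectSpace_mem_orthogonal
      (V.minimalUnitaryExtension.extend_inCommutant A hAV) (Φ := ContinuousLinearMap.id ℂ _)
      (fun _ _ => rfl) hinvariant horthogonal _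
    have hx₀ : x.snd 0 ∈ M₀ := Submodule.mem_map_of_mem hx
    exact inner_self_eq_zero.1 (Submodule.inner_right_of_mem_orthogonal hx₀ hmem)
  | succ j ih =>
    intro x hx
    rw [← adjoint_shiftIsometry_snd hS, ih _ (hadjoint hx)]

theorem model_isPure (hV : V.IsCompletelyNonunitary) :
    (V.model A hA hAV).IsPure {k : Set.Iio (n + 1) | k.1 < n} := by
  rw [isPure_initial_iff]
  intro M hM hsurj
  have hfst : ∀ x ∈ M, x.fst = 0 := by
    intro x hx
    have hmem := (V.intertwines_fst hA hAV).map_mem_unitaryPart (le_unitaryPart hsurj hx)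
    rwa [(isCompletelyNonunitary_iff V).1 hV] at hmem
  exact (Submodule.eq_bot_iff M).2 fun x hx => modelSpace_ext (hfst x hx) fun j =>
    V.snd_eq_zero_of_isReducing hA hAV hM hfst j x hx

end Model

section IntertwiningExtension

variable {ι : Type u} {H : Type v} [NormedAddCommGroup H] [InnerProductSpace ℂ H]
  {K : Type w} [NormedAddCommGroup K] [InnerProductSpace ℂ K]
  {V : CommutingIsometries ι H} (E : V.MinimalUnitaryExtension) {W : CommutingIsometries ι K}
  {X : H →L[ℂ] K}

/-- The pairs `(U_l^* h, y)` with `W_l y = X h`, where `U` is the family of the minimal unitary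
extension `E` and `l` is a word: the graph of the extension of `X`, before closure. -/
def intertwinerGraph (hX : V.Intertwines W X) : Submodule ℂ (E.space × K) where
  carrier := {p | ∃ (l : List ι) (h : H), E.family.word l p.1 = E.emb h ∧ W.word l p.2 = X h}
  zero_mem' := ⟨[], 0, by simp, by simp⟩
  add_mem' := by
    rintro p q ⟨l, h, hp, hp'⟩ ⟨m, k, hq, hq'⟩
    refine ⟨l ++ m, V.word m h + V.word l k, ?_, ?_⟩
    · rw [Prod.fst_add, map_add, word_append, word_append, hq, word_comm, hp, E.word_emb,
        E.word_emb, map_add]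
    · rw [Prod.snd_add, map_add, word_append, word_append, hq', word_comm, hp', map_add,
        hX.word, hX.word]
  smul_mem' := by
    rintro c p ⟨l, h, hp, hp'⟩
    refine ⟨l, c • h, ?_, ?_⟩
    · rw [Prod.smul_fst, map_smul, hp, map_smul]
    · rw [Prod.smul_snd, map_smul, hp', map_smul]

theorem op_mem_intertwinerGraph (hX : V.Intertwines W X) (i : ι) {x : E.space} {y : K}
    (hxy : (x, y) ∈ intertwinerGraph E hX) :
    (E.family.op i x, W.op i y) ∈ intertwinerGraph E hX := by
  obtain ⟨l, h, hx, hy⟩ := hxy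
  refine ⟨l, V.op i h, ?_, ?_⟩
  · rw [word_op_comm, hx, E.extends_op]
  · rw [word_op_comm, hy, hX]

theorem norm_snd_le_of_mem_intertwinerGraph (hX : V.Intertwines W X) {p : E.space × K}
    (hp : p ∈ intertwinerGraph E hX) : ‖p.2‖ ≤ ‖X‖ * ‖p.1‖ := by
  obtain ⟨l, h, hfst, hsnd⟩ := hp
  rw [← W.monoid_norm (W.word_mem l), hsnd, ← E.family.monoid_norm (E.family.word_mem l), hfst,
    E.emb.norm_map]
  exact X.le_opNorm h

theorem exists_intertwining_extension [CompleteSpace K] (hX : V.Intertwines W X)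
    (hXW : ∀ h, X h ∈ W.unitaryPart) :
    ∃ Y : E.space →L[ℂ] K, E.family.Intertwines W Y ∧ ∀ h, Y (E.emb h) = X h := by
  let fst := LinearMap.fst ℂ E.space K ∘ₗ (intertwinerGraph E hX).subtype
  let snd := LinearMap.snd ℂ E.space K ∘ₗ (intertwinerGraph E hX).subtype
  have hdense : DenseRange fst := by
    refine E.dense_word_mem.mono ?_
    rintro x ⟨l, h, hx⟩
    obtain ⟨y, -, hy⟩ := W.surjOn_word_unitaryPart l (hXW h)
    exact ⟨⟨(x, y), l, h, hx, hy⟩, rfl⟩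
  have hext {x : E.space} {y : K} (hxy : (x, y) ∈ intertwinerGraph E hX) :
      snd.extendOfNorm fst x = y :=
    LinearMap.extendOfNorm_eq hdense
      ⟨‖X‖, fun p => norm_snd_le_of_mem_intertwinerGraph E hX p.2⟩ ⟨(x, y), hxy⟩
  refine ⟨snd.extendOfNorm fst, fun i x => ?_, fun h => hext ⟨[], h, rfl, rfl⟩⟩
  refine hdense.induction_on x (isClosed_eq (by fun_prop) (by fun_prop)) ?_
  rintro ⟨⟨x, y⟩, hxy⟩
  exact (hext (op_mem_intertwinerGraph E hX i hxy)).trans (congrArg (W.op i) (hext hxy).symm)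

variable {E}

theorem exists_defectSpace_isometry [CompleteSpace K] (hX : V.Intertwines W X)
    (hXW : ∀ h, X h ∈ W.unitaryPart) {T : E.space →L[ℂ] E.space} (hT : E.family.InCommutant T)
    (hXT : ∀ h, ‖X h‖ = ‖defectMap T (E.emb h)‖) :
    ∃ Φ : defectSpace T →ₗᵢ[ℂ] K,
      (defectFamily E.unitary hT).Intertwines W Φ.toContinuousLinearMap ∧
      ∀ h, Φ (defectMap T (E.emb h)) = X h := by
  obtain ⟨Y, hY, hYX⟩ := exists_intertwining_extension E hX hXW
  have hdefect := intertwines_defectMap E.unitary hT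
  have hYT (x : E.space) : ‖Y x‖ = ‖defectMap T x‖ := by
    refine E.induction_on x (isClosed_eq Y.continuous.norm (defectMap T).continuous.norm)
      (fun h => (congrArg norm (hYX h)).trans (hXT h)) fun i x hx => ?_
    rwa [hY, hdefect, norm_op, norm_op] at hx
  obtain ⟨Φ, hΦ⟩ := exists_linearIsometry_comp_eq (denseRange_defectMap T) hYT
  refine ⟨Φ, fun i d => ?_, fun h => (hΦ _).trans (hYX h)⟩
  refine (denseRange_defectMap T).induction_on d
    (isClosed_eq (Φ.continuous.comp (ContinuousLinearMap.continuous _))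
      ((W.op i).continuous.comp Φ.continuous)) fun x => ?_
  rw [LinearIsometry.coe_toContinuousLinearMap, ← hdefect, hΦ, hY, hΦ]

end IntertwiningExtension

section Realization

variable {n : Ordinal.{u}} {H : Type v} [NormedAddCommGroup H] [InnerProductSpace ℂ H]
  [CompleteSpace H] {V : NIsometry n H} {A : H →L[ℂ] H} {hAV : V.InCommutant A}
  {K : Type w} [NormedAddCommGroup K] [InnerProductSpace ℂ K] {W : NIsometry (n + 1) K}

/-- Copies of `H` and of the defect space `𝔇` inside the space of `W` on which `W` acts as the model
`W_A` acts on `h ⊕ d_0 ⊕ 0 ⊕ ⋯`. The copy of `H` is the orthogonal complement of the unitary part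
`N` of the first `n` operators, and the copy of `𝔇` is orthogonal to `W_n N`. -/
structure ModelRealization (V : NIsometry n H) {A : H →L[ℂ] H} (hAV : V.InCommutant A)
    (W : NIsometry (n + 1) K) where
  base : H →ₗᵢ[ℂ] K
  wandering : V.modelDefectSpace A hAV →ₗᵢ[ℂ] K
  intertwines_base : V.Intertwines W.initial base.toContinuousLinearMap
  intertwines_wandering :
    (V.modelDefectFamily hAV).Intertwines W.initial wandering.toContinuousLinearMap
  last_base : ∀ h, W.last (base h) = base (A h) + wandering (V.modelDefectMap A hAV h)
  orthogonal_range_base : (LinearMap.range base.toLinearMap)ᗮ = W.initial.unitaryPart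
  wandering_mem : ∀ d, wandering d ∈ (W.initial.unitaryPart.map W.last.toLinearMap)ᗮ

namespace ModelRealization

variable (R : ModelRealization V hAV W)

/-- The isometry `W_n ^ j` on the copy of `𝔇`. -/
def coord (j : ℕ) : V.modelDefectSpace A hAV →ₗᵢ[ℂ] K :=
  (W.last ^ j).comp R.wandering

theorem coord_succ (j : ℕ) (d : V.modelDefectSpace A hAV) :
    R.coord (j + 1) d = W.last (R.coord j d) :=
  congrArg (fun S : K →ₗᵢ[ℂ] K => S (R.wandering d)) (pow_succ' W.last j)

theorem intertwines_coord (j : ℕ) :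
    (V.modelDefectFamily hAV).Intertwines W.initial (R.coord j).toContinuousLinearMap := by
  induction j with
  | zero => exact R.intertwines_wandering
  | succ j ih =>
    intro k d
    exact (R.coord_succ j _).trans ((congrArg W.last (ih k d)).trans
      ((W.intertwines_last k _).trans (congrArg _ (R.coord_succ j d).symm)))

theorem coord_mem_unitaryPart (j : ℕ) (d : V.modelDefectSpace A hAV) :
    R.coord j d ∈ W.initial.unitaryPart := by
  refine (R.intertwines_coord j).map_mem_unitaryPart ?_
  rw [unitaryPart_defectFamily]
  trivial

theorem orthogonalFamily_coord :
    OrthogonalFamily ℂ (fun _ : ℕ => V.modelDefectSpace A hAV) R.coord := by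
  refine orthogonalFamily_pow_comp W.last R.wandering fun j d e => ?_
  have hmem : W.last (R.coord j e) ∈ W.initial.unitaryPart.map W.last.toLinearMap :=
    Submodule.mem_map_of_mem (R.coord_mem_unitaryPart j e)
  rw [← R.coord_succ] at hmem
  exact Submodule.inner_left_of_mem_orthogonal hmem (R.wandering_mem d)

variable [CompleteSpace K]

theorem orthogonal_range_linearIsometry_coord :
    (LinearMap.range R.orthogonalFamily_coord.linearIsometry.toLinearMap)ᗮ =
      ⨅ j, (LinearMap.range (R.coord j).toLinearMap)ᗮ := by
  rw [OrthogonalFamily.range_linearIsometry, Submodule.orthogonal_closure,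
    Submodule.iInf_orthogonal]

theorem range_linearIsometry_coord_le :
    LinearMap.range R.orthogonalFamily_coord.linearIsometry.toLinearMap ≤
      W.initial.unitaryPart := by
  rw [OrthogonalFamily.range_linearIsometry]
  refine Submodule.topologicalClosure_minimal _ (iSup_le fun j => ?_) W.initial.isClosed_unitaryPart
  rintro _ ⟨d, rfl⟩
  exact R.coord_mem_unitaryPart j d

/-- The embedding `h ⊕ d_0 ⊕ d_1 ⊕ ⋯ ↦ h + d_0 + W_n d_1 + W_n ^ 2 d_2 + ⋯` of the space of the
model. -/
def isometry : ModelSpace H (V.modelDefectSpace A hAV) →ₗᵢ[ℂ] K :=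
  sumIsometry R.base R.orthogonalFamily_coord.linearIsometry fun h f => by
    have hf := R.range_linearIsometry_coord_le (LinearMap.mem_range_self _ f)
    rw [← R.orthogonal_range_base] at hf
    exact Submodule.inner_right_of_mem_orthogonal (LinearMap.mem_range_self _ h) hf

theorem isometry_eq_of_hasSum {x : ModelSpace H (V.modelDefectSpace A hAV)} {y : K}
    (hy : HasSum (fun j => R.coord j (x.snd j)) y) : R.isometry x = R.base x.fst + y :=
  congrArg (R.base x.fst + ·) ((R.orthogonalFamily_coord.hasSum_linearIsometry x.snd).unique hy)

theorem exists_hasSum (x : ModelSpace H (V.modelDefectSpace A hAV)) :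
    ∃ y, HasSum (fun j => R.coord j (x.snd j)) y :=
  ⟨_, R.orthogonalFamily_coord.hasSum_linearIsometry x.snd⟩

theorem intertwines_isometry (hA : ‖A‖ ≤ 1) :
    (V.model A hA hAV).initial.Intertwines W.initial R.isometry.toContinuousLinearMap := by
  intro k x
  obtain ⟨y, hy⟩ := R.exists_hasSum x
  have hsum : HasSum (fun j => R.coord j (((V.model A hA hAV).initial.op k x).snd j))
      (W.initial.op k y) := by
    refine (hy.mapL (W.initial.op k)).congr_fun fun j => ?_
    exact (congrArg (R.coord j) (V.intertwines_defectCoord hA hAV j k x)).trans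
      (R.intertwines_coord j k _)
  change R.isometry _ = W.initial.op k (R.isometry x)
  rw [R.isometry_eq_of_hasSum hsum, R.isometry_eq_of_hasSum hy, map_add]
  congr 1
  exact (congrArg R.base (V.intertwines_fst hA hAV k x)).trans (R.intertwines_base k _)

theorem isometry_model_last (hA : ‖A‖ ≤ 1) (x : ModelSpace H (V.modelDefectSpace A hAV)) :
    R.isometry ((V.model A hA hAV).last x) = W.last (R.isometry x) := by
  obtain ⟨y, hy⟩ := R.exists_hasSum x
  rw [model_last]
  have hsum : HasSum (fun j => R.coord j ((shiftIsometry A (V.modelDefectMap A hAV)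
      (V.norm_sq_modelDefectMap A hA hAV) x).snd j))
      (R.wandering (V.modelDefectMap A hAV x.fst) + W.last y) := by
    refine HasSum.zero_add ?_
    refine (hy.mapL W.last.toContinuousLinearMap).congr_fun fun j => ?_
    exact R.coord_succ j (x.snd j)
  rw [R.isometry_eq_of_hasSum hsum, R.isometry_eq_of_hasSum hy, map_add, R.last_base, add_assoc]
  rfl

theorem mem_orthogonal_range_isometry {y : K} :
    y ∈ (LinearMap.range R.isometry.toLinearMap)ᗮ ↔
      y ∈ W.initial.unitaryPart ∧ ∀ j, y ∈ (LinearMap.range (R.coord j).toLinearMap)ᗮ := by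
  rw [isometry, range_sumIsometry, ← Submodule.inf_orthogonal, R.orthogonal_range_base,
    R.orthogonal_range_linearIsometry_coord, Submodule.mem_inf, Submodule.mem_iInf]

theorem isInvariant_range_isometry (hA : ‖A‖ ≤ 1) :
    W.IsInvariant (LinearMap.range R.isometry.toLinearMap) := by
  refine (W.isInvariant_iff _).2 ⟨?_, ?_⟩
  · rintro k _ ⟨x, rfl⟩
    exact ⟨_, R.intertwines_isometry hA k x⟩
  · rintro _ ⟨x, rfl⟩
    exact ⟨_, R.isometry_model_last hA x⟩

theorem isInvariant_orthogonal_range_isometry :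
    W.IsInvariant (LinearMap.range R.isometry.toLinearMap)ᗮ := by
  refine (W.isInvariant_iff _).2 ⟨fun k y hy => ?_, fun y hy => ?_⟩ <;>
    obtain ⟨hyN, hy⟩ := R.mem_orthogonal_range_isometry.1 hy
  · refine R.mem_orthogonal_range_isometry.2 ⟨W.initial.op_mem_unitaryPart k hyN, fun j => ?_⟩
    refine mapsTo_orthogonal_of_surjOn (W.initial.norm_op k) ?_ (hy j)
    rintro _ ⟨d, rfl⟩
    obtain ⟨e, rfl⟩ := surjective_defectFamily V.minimalUnitaryExtension.unitary
      (V.minimalUnitaryExtension.extend_inCommutant A hAV) k d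
    exact ⟨R.coord j e, ⟨e, rfl⟩, (R.intertwines_coord j k e).symm⟩
  · refine R.mem_orthogonal_range_isometry.2
      ⟨W.intertwines_last.map_mem_unitaryPart hyN, fun j => (Submodule.mem_orthogonal _ _).2 ?_⟩
    rintro _ ⟨d, rfl⟩
    cases j with
    | zero =>
      exact Submodule.inner_left_of_mem_orthogonal (Submodule.mem_map_of_mem hyN)
        (R.wandering_mem d)
    | succ j =>
      change ⟪R.coord (j + 1) d, W.last y⟫_ℂ = 0
      rw [R.coord_succ, LinearIsometry.inner_map_map]
      exact Submodule.inner_right_of_mem_orthogonal (LinearMap.mem_range_self _ d) (hy j)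

theorem surjective_isometry (hA : ‖A‖ ≤ 1) (hW : W.IsPure {k : Set.Iio (n + 1) | k.1 < n}) :
    Function.Surjective R.isometry := by
  set S := LinearMap.range R.isometry.toLinearMap
  have : CompleteSpace S :=
    R.isometry.isometry.isClosedEmbedding.isClosed_range.completeSpace_coe (s := (S : Set K))
  have hS := R.isInvariant_range_isometry hA
  have hreducing : W.IsReducing Sᗮ :=
    ⟨S.isClosed_orthogonal, R.isInvariant_orthogonal_range_isometry, by
      rwa [S.orthogonal_orthogonal]⟩
  have hbot : Sᗮ = ⊥ := by
    refine W.isPure_initial_iff.1 hW _ hreducing fun k y hy => ?_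
    obtain ⟨z, -, rfl⟩ := W.initial.surjOn_unitaryPart k (R.mem_orthogonal_range_isometry.1 hy).1
    exact ⟨z, mem_orthogonal_of_map_mem_orthogonal (W.initial.norm_op k) (hS (castIndex k)) hy, rfl⟩
  exact LinearMap.range_eq_top.1 (Submodule.orthogonal_eq_bot_iff.1 hbot)

theorem unitarilyEquivalent_model (R : ModelRealization V hAV W) (hA : ‖A‖ ≤ 1)
    (hW : W.IsPure {k : Set.Iio (n + 1) | k.1 < n}) :
    W.UnitarilyEquivalent (V.model A hA hAV) :=
  UnitarilyEquivalent.symm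
    ⟨LinearIsometryEquiv.ofSurjective R.isometry (R.surjective_isometry hA hW),
      forall_index_iff.2 ⟨R.intertwines_isometry hA, R.isometry_model_last hA⟩⟩

end ModelRealization

end Realization

section Compression

variable {n : Ordinal.{u}} {K : Type v} [NormedAddCommGroup K] [InnerProductSpace ℂ K]
  [CompleteSpace K] (W : NIsometry (n + 1) K)

/-- The compression of the last operator of `W` to the completely nonunitary part of the others:
the operator `A` of the model. -/
def compression :
    (W.initial.unitaryPartᗮ : Submodule ℂ K) →L[ℂ] (W.initial.unitaryPartᗮ : Submodule ℂ K) :=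
  W.initial.unitaryPartᗮ.orthogonalProjectionOnto ∘L W.last.toContinuousLinearMap ∘L
    W.initial.unitaryPartᗮ.subtypeL

/-- The off-diagonal entry of the last operator of `W`, from the completely nonunitary part of the
other operators to their unitary part. -/
def crossTerm : (W.initial.unitaryPartᗮ : Submodule ℂ K) →L[ℂ] K :=
  W.initial.unitaryPart.starProjection ∘L W.last.toContinuousLinearMap ∘L
    W.initial.unitaryPartᗮ.subtypeL

theorem crossTerm_mem (h : (W.initial.unitaryPartᗮ : Submodule ℂ K)) :
    W.crossTerm h ∈ W.initial.unitaryPart :=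
  W.initial.unitaryPart.starProjection_apply_mem _

theorem last_eq_compression_add_crossTerm (h : (W.initial.unitaryPartᗮ : Submodule ℂ K)) :
    W.last h = W.compression h + W.crossTerm h :=
  ((add_comm _ _).trans
    (W.initial.unitaryPart.starProjection_add_starProjection_orthogonal (W.last h))).symm

theorem norm_sq_compression_add_norm_sq_crossTerm
    (h : (W.initial.unitaryPartᗮ : Submodule ℂ K)) :
    ‖W.compression h‖ ^ 2 + ‖W.crossTerm h‖ ^ 2 = ‖h‖ ^ 2 := by
  rw [Submodule.coe_norm h, ← W.last.norm_map (h : K), add_comm]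
  exact (Submodule.norm_sq_eq_add_norm_sq_projection (W.last h) W.initial.unitaryPart).symm

theorem norm_compression_le : ‖W.compression‖ ≤ 1 := by
  refine W.compression.opNorm_le_bound zero_le_one fun h => ?_
  rw [one_mul]
  refine (sq_le_sq₀ (norm_nonneg _) (norm_nonneg _)).1 ?_
  rw [← W.norm_sq_compression_add_norm_sq_crossTerm h]
  exact le_add_of_nonneg_right (sq_nonneg ‖W.crossTerm h‖)

theorem inCommutant_compression : W.initial.nonunitaryPart.InCommutant W.compression := by
  have hproj := W.initial.isReducing_unitaryPart.orthogonal.inCommutant_starProjection.intertwines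
  have hcomp := hproj.comp (W.intertwines_last.comp W.initial.intertwines_subtypeL_nonunitaryPart)
  exact fun k => ContinuousLinearMap.ext fun h => Subtype.ext (hcomp k h)

theorem intertwines_crossTerm : W.initial.nonunitaryPart.Intertwines W.initial W.crossTerm :=
  W.initial.isReducing_unitaryPart.inCommutant_starProjection.intertwines.comp
    (W.intertwines_last.comp W.initial.intertwines_subtypeL_nonunitaryPart)

theorem crossTerm_mem_orthogonal (h : (W.initial.unitaryPartᗮ : Submodule ℂ K)) :
    W.crossTerm h ∈ (W.initial.unitaryPart.map W.last.toLinearMap)ᗮ := by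
  have hcompl {g z : K} (hg : g ∈ W.initial.unitaryPartᗮ) (hz : z ∈ W.initial.unitaryPart) :
      ⟪z, g⟫_ℂ = 0 := Submodule.inner_right_of_mem_orthogonal hz hg
  refine (Submodule.mem_orthogonal _ _).2 ?_
  rintro _ ⟨z, hz, rfl⟩
  have hlast : W.last z ∈ W.initial.unitaryPart := W.intertwines_last.map_mem_unitaryPart hz
  change ⟪W.last z, W.crossTerm h⟫_ℂ = 0
  rw [← add_sub_cancel_left (W.compression h : K) (W.crossTerm h),
    ← W.last_eq_compression_add_crossTerm, inner_sub_right, LinearIsometry.inner_map_map,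
    hcompl h.2 hz, hcompl (W.compression h).2 hlast, sub_zero]

theorem nonempty_modelRealization :
    Nonempty (ModelRealization W.initial.nonunitaryPart W.inCommutant_compression W) := by
  set V := W.initial.nonunitaryPart
  set E := V.minimalUnitaryExtension
  have hA := W.norm_compression_le
  have hAV := W.inCommutant_compression
  have hnorm (h) : ‖W.crossTerm h‖ = ‖defectMap (E.extend _ hAV) (E.emb h)‖ := by
    refine (sq_eq_sq₀ (norm_nonneg _) (norm_nonneg _)).1 (add_left_cancel
      ((W.norm_sq_compression_add_norm_sq_crossTerm h).trans
        (V.norm_sq_modelDefectMap W.compression hA hAV h).symm))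
  obtain ⟨Φ, hΦ, hΦX⟩ := exists_defectSpace_isometry W.intertwines_crossTerm W.crossTerm_mem
    (E.extend_inCommutant _ hAV) hnorm
  have hinvariant : W.initial.IsInvariant (W.initial.unitaryPart.map W.last.toLinearMap) := by
    rintro k _ ⟨z, hz, rfl⟩
    exact ⟨_, W.initial.op_mem_unitaryPart k hz, W.intertwines_last k z⟩
  exact ⟨{
    base := W.initial.unitaryPartᗮ.subtypeₗᵢ
    wandering := Φ
    intertwines_base := fun _ _ => rfl
    intertwines_wandering := hΦ
    last_base := fun h => (W.last_eq_compression_add_crossTerm h).trans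
      (congrArg ((W.compression h : K) + ·) (hΦX h).symm)
    orthogonal_range_base := by
      rw [Submodule.subtypeₗᵢ_toLinearMap, Submodule.range_subtype,
        Submodule.orthogonal_orthogonal]
    wandering_mem := E.map_defectSpace_mem_orthogonal _ hΦ hinvariant fun h => by
      rw [LinearIsometry.coe_toContinuousLinearMap, hΦX]
      exact W.crossTerm_mem_orthogonal h }⟩

end Compression

end CommutingIsometries

end

theorem theorem3p1 {K : Type v} [NormedAddCommGroup K] [InnerProductSpace ℂ K] [CompleteSpace K]
    (n : Ordinal.{u}) (hn : 1 ≤ n) (W : NIsometry (n + 1) K) :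
    W.IsPure {k : Set.Iio (n + 1) | k.1 < n} ↔
      ∃ (H : Type v) (_ : NormedAddCommGroup H) (_ : InnerProductSpace ℂ H) (_ : CompleteSpace H)
        (V : NIsometry n H) (A : H →L[ℂ] H) (hA : ‖A‖ ≤ 1) (hAV : V.InCommutant A),
        V.IsCompletelyNonunitary ∧ W.UnitarilyEquivalent (V.model A hA hAV) := by
  constructor
  · intro hW
    obtain ⟨R⟩ := W.nonempty_modelRealization
    exact ⟨_, _, _, inferInstance, W.initial.nonunitaryPart, W.compression, W.norm_compression_le,
      W.inCommutant_compression, W.initial.isCompletelyNonunitary_nonunitaryPart,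
      R.unitarilyEquivalent_model _ hW⟩
  · rintro ⟨H, _, _, _, V, A, hA, hAV, hV, hWA⟩
    exact hWA.isPure (V.model_isPure hA hAV hV)
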